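/- **Setting.** Consider the master system $$\dot x=Ax+\varphi_0(y)+b\,\varphi(y)^T\theta,\qquad y=c^Tx,\qquad x(t)\in\mathbb R^n,\ \theta\in\mathbb R^m,$$ where $\varphi_0:\mathbb R\to\mathbb R^n$ and $\varphi:\mathbb R\to\mathbb R^m$ are bounded on bounded sets, $\varphi$ is continuous, and for every $\theta$ every trajectory $x$ on $[0,\infty)$ is bounded. Let $k\in\mathbb R^n$ be such that $F=A-kc^T$ is Hurwitz, let $H(p)=c^T(pI-F)^{-1}b\neq0$ have relative degree $r$, let $\lambda>0$ and $W(p)=(p+\lambda)H(p)$. For signals on $[0,\infty)$ write $v=W(p)[u]$ if $\dot z=Fz+bu$ and $v=c^T(F+\lambda I)z+c^Tb\,u$ for some filter state $z$ with arbitrary initial value (this is a realization of $W$), and write $u=W(p)^{-1}[v]$ if $v=W(p)[u]$. The closed loop consists of the master system, the observer $$\dot{\hat x}=A\hat x+\varphi_0(y)+b\,\nu+k(y-\hat y),\qquad \hat y=c^T\hat x,$$ the regressor $\varpi_i=W(p)[\varphi_i(y)]$, the feedback $\nu=W(p)^{-1}[\varpi^T\hat\theta]$, and, with $e=y-\hat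 y$, the high-order tuner $$\dot\psi_i=\varpi_i e,\qquad \dot\eta_i=(1+\mu\varpi^T\varpi)(\Gamma\eta_i+h\psi_i),\qquad \hat\theta_i=l^T\eta_i\qquad(i=1,\dots,m),$$ where $(l,\Gamma,h)$ is a minimal realization of $\alpha(0)/\alpha(p)=l^T(pI-\Gamma)^{-1}h$ for a Hurwitz polynomial $\alpha$ of degree $r-2$. If $r\le2$, the filters $\eta_i$ are omitted and $\hat\theta=\psi$, i.e. $\dot{\hat\theta}=\varpi e$. $H$ is called minimum phase if all its zeros have negative real part. A function $f:[0,\infty)\to\mathbb R^m$ is persistently exciting if it is measurable and bounded and there are $a,T>0$ with $\int_t^{t+T}f(s)f(s)^Tds\ge aI$ for all $t\ge0$. **Theorem 2.** (i) Let $P$ be the positive definite matrix with $\Gamma^TP+P\Gamma=-2I$ and let $$\mu>\frac{3}{4\lambda}\bigl(|l|+|P\Gamma^{-1}h|\bigr)^2$$ (for $r\le2$ this condition is only $\mu>0$, and $\mu$ plays no role). Then, for any initial conditions, along every trajectory of the closed loop on $[0,\infty)$ the signals $x$, $y$, $\varphi_0(y)$, $\varphi(y)$, $\hat y$, $\varpi$,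 the states of the filters generating $\varpi$, and $\psi_i$, $\eta_i$, $\hat\theta$ are bounded, and $y(t)-\hat y(t)\to0$ as $t\to\infty$. If $H$ is minimum phase (so that the filter $W(p)^{-1}$ is stable), the remaining signals, namely $\nu$, the state of the filter defining $W(p)^{-1}$, and $\hat x$, are bounded too. (ii) If in addition $t\mapsto\varphi(y(t))$ is persistently exciting and $H$ is minimum phase, then $|\theta-\hat\theta(t)|\to0$ as $t\to\infty$. -/

import Mathlib

open Filter Topology Matrix

noncomputable section

namespace HOT

/-- A real polynomial is Hurwitz if it is nonzero and all its complex roots have negative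
real part. -/
def HurwitzPoly (a : Polynomial ℝ) : Prop :=
  a ≠ 0 ∧ ∀ z : ℂ, Polynomial.aeval z a = 0 → z.re < 0

/-- A real square matrix is Hurwitz if all its eigenvalues have negative real part. -/
def HurwitzMatrix {n : ℕ} (F : Matrix (Fin n) (Fin n) ℝ) : Prop :=
  HurwitzPoly F.charpoly

/-- The transfer function `gᵀ (p I - F)⁻¹ b + d` as a rational function of `p`. -/
def transferFn {n : ℕ} (F : Matrix (Fin n) (Fin n) ℝ) (b g : Fin n → ℝ) (d : ℝ) : RatFunc ℝ :=
  (fun i => RatFunc.C (g i)) ⬝ᵥ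
      (((RatFunc.X : RatFunc ℝ) • (1 : Matrix (Fin n) (Fin n) (RatFunc ℝ)) -
          F.map RatFunc.C)⁻¹ *ᵥ fun i => RatFunc.C (b i)) +
    RatFunc.C d

/-- The nonzero transfer function `H` has relative degree `r`
(degree of the denominator minus degree of the numerator). -/
def HasRelativeDegree (H : RatFunc ℝ) (r : ℕ) : Prop :=
  H ≠ 0 ∧ H.intDegree = -(r : ℤ)

/-- All (finite) zeros of `H` lie in the open left half-plane. -/
def MinimumPhase (H : RatFunc ℝ) : Prop :=
  HurwitzPoly H.num

/-- Boundedness of a signal on `[0, ∞)`. -/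
def BoundedSignal {E : Type*} [Norm E] (f : ℝ → E) : Prop :=
  ∃ C : ℝ, ∀ t : ℝ, 0 ≤ t → ‖f t‖ ≤ C

/-- Persistent excitation on `[0, ∞)`: `f` is measurable and bounded there and
`∫_t^{t+T} f(s) f(s)ᵀ ds ≥ α I` for some `α, T > 0` and all `t ≥ 0`. -/
def PersistentlyExciting {m : ℕ} (f : ℝ → Fin m → ℝ) : Prop :=
  Measurable (fun t : Set.Ici (0 : ℝ) => f t) ∧ BoundedSignal f ∧
    ∃ α > (0 : ℝ), ∃ T > (0 : ℝ), ∀ t : ℝ, 0 ≤ t →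
      (Matrix.of (fun i j : Fin m => ∫ s in t..(t + T), f s i * f s j) -
        α • (1 : Matrix (Fin m) (Fin m) ℝ)).PosSemidef

/-- `v` is an output, for the input `u`, of the filter with transfer function
`gᵀ (p I - F)⁻¹ b + d`, and `z` is the corresponding state; the initial state is arbitrary. -/
structure FilterResponse {n : ℕ} (F : Matrix (Fin n) (Fin n) ℝ) (b g : Fin n → ℝ) (d : ℝ)
    (u : ℝ → ℝ) (z : ℝ → Fin n → ℝ) (v : ℝ → ℝ) : Prop where
  state : ∀ t : ℝ, 0 ≤ t → HasDerivWithinAt z (F *ᵥ z t + u t • b) (Set.Ici 0) t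
  output : ∀ t : ℝ, 0 ≤ t → v t = g ⬝ᵥ z t + d * u t

/-- Data of the master system `x' = A x + φ₀(y) + b φ(y)ᵀ θ`, `y = cᵀ x`. -/
structure Plant (n m : ℕ) where
  A : Matrix (Fin n) (Fin n) ℝ
  b : Fin n → ℝ
  c : Fin n → ℝ
  φ₀ : ℝ → Fin n → ℝ
  φ : ℝ → Fin m → ℝ

/-- `x` is a trajectory on `[0, ∞)` of the master system with parameter `θ`. -/
def Plant.IsTrajectory {n m : ℕ} (S : Plant n m) (θ : Fin m → ℝ) (x : ℝ → Fin n → ℝ) : Prop :=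
  ∀ t : ℝ, 0 ≤ t →
    HasDerivWithinAt x
      (S.A *ᵥ x t + S.φ₀ (S.c ⬝ᵥ x t) + (S.φ (S.c ⬝ᵥ x t) ⬝ᵥ θ) • S.b) (Set.Ici 0) t

/-- Every trajectory of the master system is bounded, whatever the parameter. -/
def Plant.BoundedTrajectories {n m : ℕ} (S : Plant n m) : Prop :=
  ∀ (θ : Fin m → ℝ) (x : ℝ → Fin n → ℝ), S.IsTrajectory θ x → BoundedSignal x

/-- `φ₀` and `φ` are bounded on bounded sets. -/
def Plant.LocallyBoundedNonlinearities {n m : ℕ} (S : Plant n m) : Prop :=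
  ∀ s : Set ℝ, Bornology.IsBounded s →
    Bornology.IsBounded (S.φ₀ '' s) ∧ Bornology.IsBounded (S.φ '' s)

/-- The matrix `F = A - k cᵀ`. -/
def Plant.errorMatrix {n m : ℕ} (S : Plant n m) (k : Fin n → ℝ) : Matrix (Fin n) (Fin n) ℝ :=
  S.A - Matrix.vecMulVec k S.c

/-- The transfer function `H(p) = cᵀ (p I - F)⁻¹ b`. -/
def Plant.H {n m : ℕ} (S : Plant n m) (k : Fin n → ℝ) : RatFunc ℝ :=
  transferFn (S.errorMatrix k) S.b S.c 0

/-- `v = W(p)[u]` with `W(p) = (p + lam) H(p)` (see `Plant.transferFn_W`), `z` being the state of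
the filter. -/
def Plant.WResponse {n m : ℕ} (S : Plant n m) (k : Fin n → ℝ) (lam : ℝ)
    (u : ℝ → ℝ) (z : ℝ → Fin n → ℝ) (v : ℝ → ℝ) : Prop :=
  FilterResponse (S.errorMatrix k) S.b ((S.errorMatrix k)ᵀ *ᵥ S.c + lam • S.c) (S.c ⬝ᵥ S.b) u z v

/-- Data of the tuner: the filter `(l, Γ, h)` and the normalization gain `μ`. -/
structure Tuner (q : ℕ) where
  Γ : Matrix (Fin q) (Fin q) ℝ
  h : Fin q → ℝ
  l : Fin q → ℝ
  μ : ℝ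

/-- The signals of the closed loop: state `x` of the master system, state `xhat` of the observer,
feedback `ν`, regressor `ϖ = W(p)[φ(y)]`, tuner signals `ψ i`, `η i`, estimate `θhat`, the states
`zφ i` of the filters generating `ϖ i`, and the state `zν` of the filter `W(p)` driven by `ν`. -/
structure Signals (n m q : ℕ) where
  x : ℝ → Fin n → ℝ
  xhat : ℝ → Fin n → ℝ
  ν : ℝ → ℝ
  ϖ : ℝ → Fin m → ℝ
  ψ : ℝ → Fin m → ℝ
  η : ℝ → Fin m → Fin q → ℝ
  θhat : ℝ → Fin m → ℝ
  zφ : ℝ → Fin m → Fin n → ℝ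
  zν : ℝ → Fin n → ℝ

/-- The equations of the closed loop on `[0, ∞)`, for a transfer function `H` of relative
degree `r`. Initial conditions are arbitrary. -/
structure IsClosedLoop {n m q : ℕ} (S : Plant n m) (k : Fin n → ℝ) (lam : ℝ) (r : ℕ)
    (D : Tuner q) (θ : Fin m → ℝ) (s : Signals n m q) : Prop where
  master : S.IsTrajectory θ s.x
  observer : ∀ t : ℝ, 0 ≤ t →
    HasDerivWithinAt s.xhat
      (S.A *ᵥ s.xhat t + S.φ₀ (S.c ⬝ᵥ s.x t) + s.ν t • S.b +
        (S.c ⬝ᵥ s.x t - S.c ⬝ᵥ s.xhat t) • k) (Set.Ici 0) t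
  regressor : ∀ i : Fin m,
    S.WResponse k lam (fun t => S.φ (S.c ⬝ᵥ s.x t) i) (fun t => s.zφ t i) (fun t => s.ϖ t i)
  /-- `ν = W(p)⁻¹[ϖᵀ θhat]`, that is, `W(p)[ν] = ϖᵀ θhat`. -/
  feedback : S.WResponse k lam s.ν s.zν (fun t => s.ϖ t ⬝ᵥ s.θhat t)
  psi : ∀ t : ℝ, 0 ≤ t →
    HasDerivWithinAt s.ψ ((S.c ⬝ᵥ s.x t - S.c ⬝ᵥ s.xhat t) • s.ϖ t) (Set.Ici 0) t
  eta : ∀ i : Fin m, ∀ t : ℝ, 0 ≤ t →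
    HasDerivWithinAt (fun τ => s.η τ i)
      ((1 + D.μ * (s.ϖ t ⬝ᵥ s.ϖ t)) • (D.Γ *ᵥ s.η t i + s.ψ t i • D.h)) (Set.Ici 0) t
  /-- If `r ≤ 2` the filters `η i` are not used, and the algorithm is `θhat' = ϖ e`. -/
  estimate : ∀ t : ℝ, 0 ≤ t → ∀ i : Fin m,
    s.θhat t i = if r ≤ 2 then s.ψ t i else D.l ⬝ᵥ s.η t i

/-- The quadruple used in `Plant.WResponse` realizes `(p + lam) H(p)`. -/
theorem Plant.transferFn_W {n m : ℕ} (S : Plant n m) (k : Fin n → ℝ) (lam : ℝ) :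
    transferFn (S.errorMatrix k) S.b ((S.errorMatrix k)ᵀ *ᵥ S.c + lam • S.c) (S.c ⬝ᵥ S.b) =
      (RatFunc.X + RatFunc.C lam) * S.H k := by
  unfold Plant.H
  set F := S.errorMatrix k with hF
  unfold transferFn
  set M : Matrix (Fin n) (Fin n) (RatFunc ℝ) :=
    (RatFunc.X : RatFunc ℝ) • (1 : Matrix (Fin n) (Fin n) (RatFunc ℝ)) - F.map RatFunc.C with hM
  have hMc : M = (algebraMap (Polynomial ℝ) (RatFunc ℝ)).mapMatrix F.charmatrix := by
    ext i j
    by_cases hij : i = j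
    · subst hij
      simp [hM, Matrix.charmatrix_apply_eq]
    · simp [hM, Matrix.charmatrix_apply_ne, hij]
  have hdet : IsUnit M.det := by
    rw [isUnit_iff_ne_zero, hMc, ← RingHom.map_det]
    intro h0
    exact F.charpoly_monic.ne_zero ((map_eq_zero_iff _ (RatFunc.algebraMap_injective ℝ)).1 h0)
  set w := M⁻¹ *ᵥ (fun i => (RatFunc.C (S.b i) : RatFunc ℝ)) with hw
  have hMw : M *ᵥ w = fun i => RatFunc.C (S.b i) := by
    rw [hw, Matrix.mulVec_mulVec, Matrix.mul_nonsing_inv _ hdet, Matrix.one_mulVec]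
  have hXw : (RatFunc.X : RatFunc ℝ) • w =
      F.map RatFunc.C *ᵥ w + fun i => RatFunc.C (S.b i) := by
    rw [← hMw, hM, Matrix.sub_mulVec, Matrix.smul_mulVec, Matrix.one_mulVec]
    abel
  have hg : (fun i => (RatFunc.C ((Fᵀ *ᵥ S.c + lam • S.c) i) : RatFunc ℝ)) =
      (fun i => RatFunc.C (S.c i)) ᵥ* F.map RatFunc.C +
        RatFunc.C lam • (fun i => (RatFunc.C (S.c i) : RatFunc ℝ)) := by
    ext i
    simp [Matrix.mulVec, Matrix.vecMul, dotProduct, map_sum, mul_comm]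
  have hd : (RatFunc.C (S.c ⬝ᵥ S.b) : RatFunc ℝ) =
      (fun i => RatFunc.C (S.c i)) ⬝ᵥ fun i => RatFunc.C (S.b i) := by
    simp [dotProduct, map_sum]
  have hX : (RatFunc.X : RatFunc ℝ) * ((fun i => RatFunc.C (S.c i)) ⬝ᵥ w) =
      (fun i => RatFunc.C (S.c i)) ⬝ᵥ (F.map RatFunc.C *ᵥ w) +
        (fun i => RatFunc.C (S.c i)) ⬝ᵥ fun i => RatFunc.C (S.b i) := by
    rw [← dotProduct_add, ← hXw, dotProduct_smul, smul_eq_mul]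
  rw [hg, hd, add_dotProduct, smul_dotProduct, ← Matrix.dotProduct_mulVec, map_zero, add_zero,
    add_mul, hX, smul_eq_mul]
  ring

end HOT

end

/-
The output error `e` obeys `e' = -λ e + ϖᵀ(θ - θ̂) + ε` with `ε` exponentially decaying. Since the
tuner filters have static gain `-lᵀΓ⁻¹h = 1`, they read out `θ̂ = ψ + lᵀξ`, where `ξ` is the
deviation of `η` from the equilibrium `-Γ⁻¹hψ`. Writing `V` for
`½ (e² + |θ - ψ|²) + c ∑ᵢ ξᵢᵀPξᵢ` plus a quadratic term that dominates `ε`, the bound on `μ` makes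
`V` a Lyapunov function, so `e`, `ψ` and `ξ` are bounded, and Barbalat's lemma gives `e → 0` and
`lᵀξ → 0`. When `H` is minimum phase, `W⁻¹` is a differential operator followed by a stable
filter; it is applied to `ϖᵀθ̂`, and the derivatives it needs are controlled because the
coefficients `ψ`, `ξ` vary slowly and can be pulled through the filters up to vanishing errors.
The same fact turns `ϖᵀ(θ - ψ) → 0` into `φᵀ(θ - ψ) → 0`, and persistent excitation concludes.
-/

namespace HOT

/-- `f` has the derivative `f' t` at every `t ≥ 0`, one-sided at `0`: the sense in which the
equations of the closed loop hold. -/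
def DerivOnIci {E : Type*} [NormedAddCommGroup E] [NormedSpace ℝ E] (f f' : ℝ → E) : Prop :=
  ∀ t : ℝ, 0 ≤ t → HasDerivWithinAt f (f' t) (Set.Ici 0) t

namespace DerivOnIci

section NormedSpace

variable {E ι : Type*} [NormedAddCommGroup E] [NormedSpace ℝ E] {f f' g g' : ℝ → E}

theorem congr_deriv (hf : DerivOnIci f f') (h : ∀ t, 0 ≤ t → f' t = g' t) : DerivOnIci f g' :=
  fun t ht => h t ht ▸ hf t ht

theorem congr (hf : DerivOnIci f f') (h : ∀ t, 0 ≤ t → g t = f t) : DerivOnIci g f' :=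
  fun t ht => (hf t ht).congr h (h t ht)

theorem unique (hf : DerivOnIci f f') (hg : DerivOnIci f g') {t : ℝ} (ht : 0 ≤ t) :
    f' t = g' t :=
  (uniqueDiffOn_Ici (0 : ℝ) t ht).eq_deriv _ (hf t ht) (hg t ht)

theorem const (c : E) : DerivOnIci (fun _ => c) (fun _ => 0) :=
  fun _ _ => hasDerivWithinAt_const _ _ _

theorem add (hf : DerivOnIci f f') (hg : DerivOnIci g g') :
    DerivOnIci (fun t => f t + g t) (fun t => f' t + g' t) :=
  fun t ht => (hf t ht).fun_add (hg t ht)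

theorem neg (hf : DerivOnIci f f') : DerivOnIci (fun t => -f t) (fun t => -f' t) :=
  fun t ht => (hf t ht).fun_neg

theorem sub (hf : DerivOnIci f f') (hg : DerivOnIci g g') :
    DerivOnIci (fun t => f t - g t) (fun t => f' t - g' t) :=
  fun t ht => (hf t ht).fun_sub (hg t ht)

theorem sum {s : Finset ι} {f f' : ι → ℝ → E} (h : ∀ i ∈ s, DerivOnIci (f i) (f' i)) :
    DerivOnIci (fun t => ∑ i ∈ s, f i t) (fun t => ∑ i ∈ s, f' i t) :=
  fun t ht => HasDerivWithinAt.fun_sum fun i hi => h i hi t ht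

theorem smul {u u' : ℝ → ℝ} (hu : DerivOnIci u u') (hf : DerivOnIci f f') :
    DerivOnIci (fun t => u t • f t) (fun t => u t • f' t + u' t • f t) :=
  fun t ht => (hu t ht).fun_smul (hf t ht)

theorem clm_apply {F : Type*} [NormedAddCommGroup F] [NormedSpace ℝ F] (L : E →L[ℝ] F)
    (hf : DerivOnIci f f') : DerivOnIci (fun t => L (f t)) (fun t => L (f' t)) :=
  fun t ht => L.hasFDerivAt.comp_hasDerivWithinAt t (hf t ht)

theorem uniformContinuousOn (hf : DerivOnIci f f') (hb : BoundedSignal f') :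
    UniformContinuousOn f (Set.Ici 0) := by
  obtain ⟨C, hC⟩ := hb
  refine ((convex_Ici 0).lipschitzOnWith_of_nnnorm_hasDerivWithin_le (C := C.toNNReal) hf
    fun t ht => ?_).uniformContinuousOn
  exact NNReal.coe_le_coe.1 ((hC t ht).trans (Real.le_coe_toNNReal C))

end NormedSpace

theorem pi_iff {ι : Type*} [Fintype ι] {E : Type*} [NormedAddCommGroup E] [NormedSpace ℝ E]
    {f f' : ℝ → ι → E} :
    DerivOnIci f f' ↔ ∀ i, DerivOnIci (fun t => f t i) (fun t => f' t i) := by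
  simp only [DerivOnIci, hasDerivWithinAt_pi]
  exact ⟨fun h i t ht => h t ht i, fun h t ht i => h i t ht⟩

theorem mul {A : Type*} [NormedRing A] [NormedAlgebra ℝ A] {f f' g g' : ℝ → A}
    (hf : DerivOnIci f f') (hg : DerivOnIci g g') :
    DerivOnIci (fun t => f t * g t) (fun t => f' t * g t + f t * g' t) :=
  fun t ht => (hf t ht).fun_mul (hg t ht)

theorem const_mul {A : Type*} [NormedRing A] [NormedAlgebra ℝ A] (c : A) {f f' : ℝ → A}
    (hf : DerivOnIci f f') : DerivOnIci (fun t => c * f t) (fun t => c * f' t) :=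
  fun t ht => (hf t ht).const_mul c

theorem const_dotProduct {ι A : Type*} [Fintype ι] [NormedRing A] [NormedAlgebra ℝ A] (a : ι → A)
    {z z' : ℝ → ι → A} (hz : DerivOnIci z z') :
    DerivOnIci (fun t => a ⬝ᵥ z t) (fun t => a ⬝ᵥ z' t) :=
  sum fun i _ => (pi_iff.1 hz i).const_mul (a i)

section Real

variable {v v' : ℝ → ℝ} {a c s t : ℝ}

theorem sub_le_mul_sub (hv : DerivOnIci v v') (hs : 0 ≤ s) (hst : s ≤ t)
    (h : ∀ x ∈ Set.Icc s t, v' x ≤ c) : v t - v s ≤ c * (t - s) := by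
  have hd : ∀ x ∈ Set.Icc s t,
      HasDerivWithinAt (fun x => v x - c * x) (v' x - c * 1) (Set.Icc s t) x := fun x hx =>
    ((hv x (hs.trans hx.1)).mono fun y hy => hs.trans hy.1).fun_sub
      ((hasDerivWithinAt_id x _).const_mul c)
  have hanti : AntitoneOn (fun x => v x - c * x) (Set.Icc s t) :=
    antitoneOn_of_hasDerivWithinAt_nonpos (convex_Icc s t)
      (fun x hx => (hd x hx).continuousWithinAt)
      (fun x hx => (hd x (interior_subset hx)).mono interior_subset)
      fun x hx => by linarith [h x (interior_subset hx)]
  have : v t - c * t ≤ v s - c * s := hanti ⟨le_rfl, hst⟩ ⟨hst, le_rfl⟩ hst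
  linarith

theorem antitoneOn (hv : DerivOnIci v v') (h : ∀ t, 0 ≤ t → v' t ≤ 0) :
    AntitoneOn v (Set.Ici 0) := fun s hs t _ hst => by
  simpa using hv.sub_le_mul_sub hs hst fun x hx => h x (le_trans hs hx.1)

theorem sub_le_mul_exp (hv : DerivOnIci v v') (hs : 0 ≤ s)
    (h : ∀ x, s ≤ x → v' x ≤ -a * (v x - c)) (hst : s ≤ t) :
    v t - c ≤ (v s - c) * Real.exp (-a * (t - s)) := by
  have hexp : DerivOnIci (fun x => Real.exp (a * x)) fun x => Real.exp (a * x) * (a * 1) :=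
    fun x _ => ((hasDerivWithinAt_id x _).const_mul a).exp
  have hdecr : (v t - c) * Real.exp (a * t) ≤ (v s - c) * Real.exp (a * s) := by
    have := ((hv.sub (const c)).mul hexp).sub_le_mul_sub (c := 0) hs hst fun x hx => by
      nlinarith [h x hx.1, Real.exp_pos (a * x)]
    linarith
  calc v t - c = (v t - c) * Real.exp (a * t) * Real.exp (-(a * t)) := by
        rw [mul_assoc, ← Real.exp_add, add_neg_cancel, Real.exp_zero, mul_one]
    _ ≤ (v s - c) * Real.exp (a * s) * Real.exp (-(a * t)) := by gcongr
    _ = (v s - c) * Real.exp (-a * (t - s)) := by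
        rw [mul_assoc, ← Real.exp_add]
        ring_nf

theorem le_max (hv : DerivOnIci v v') (ha : 0 < a)
    (h : ∀ x, 0 ≤ x → v' x ≤ -a * (v x - c)) (ht : 0 ≤ t) : v t ≤ max (v 0) c := by
  have hexp : Real.exp (-a * (t - 0)) ≤ 1 := Real.exp_le_one_iff.2 (by nlinarith)
  have hle := hv.sub_le_mul_exp le_rfl h ht
  rcases le_total (v 0) c with hc | hc
  · exact le_max_of_le_right (by nlinarith [Real.exp_pos (-a * (t - 0))])
  · exact le_max_of_le_left (by nlinarith)

theorem eventually_lt (hv : DerivOnIci v v') (ha : 0 < a)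
    (h : ∀ᶠ x in atTop, v' x ≤ -a * (v x - c)) {ε : ℝ} (hε : 0 < ε) :
    ∀ᶠ x in atTop, v x < c + ε := by
  obtain ⟨s, hs⟩ := eventually_atTop.1 (h.and (eventually_ge_atTop 0))
  have hexp : Tendsto (fun x => (v s - c) * Real.exp (-a * (x - s))) atTop (𝓝 0) := by
    have hbot : Tendsto (fun x => -a * (x - s)) atTop atBot :=
      (tendsto_atTop_add_const_right _ _ tendsto_id).const_mul_atTop_of_neg (neg_lt_zero.2 ha)
    simpa using (Real.tendsto_exp_atBot.comp hbot).const_mul (v s - c)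
  filter_upwards [eventually_ge_atTop s, hexp.eventually_lt_const hε] with x hx hlt
  linarith [hv.sub_le_mul_exp (hs s le_rfl).2 (fun y hy => (hs y hy).1) hx]

end Real

end DerivOnIci

section Bounded

variable {E : Type*} [NormedAddCommGroup E] {f g : ℝ → E}

theorem boundedSignal_iff_isBigO :
    BoundedSignal f ↔ f =O[𝓟 (Set.Ici 0)] fun _ => (1 : ℝ) := by
  simp [BoundedSignal, Asymptotics.isBigO_iff]

namespace BoundedSignal

theorem congr (hf : BoundedSignal f) (h : ∀ t, 0 ≤ t → g t = f t) : BoundedSignal g := by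
  obtain ⟨C, hC⟩ := hf
  exact ⟨C, fun t ht => h t ht ▸ hC t ht⟩

theorem const (c : E) : BoundedSignal fun _ => c := ⟨‖c‖, fun _ _ => le_rfl⟩

theorem add (hf : BoundedSignal f) (hg : BoundedSignal g) : BoundedSignal fun t => f t + g t :=
  boundedSignal_iff_isBigO.2
    ((boundedSignal_iff_isBigO.1 hf).add (boundedSignal_iff_isBigO.1 hg))

theorem sub (hf : BoundedSignal f) (hg : BoundedSignal g) : BoundedSignal fun t => f t - g t :=
  boundedSignal_iff_isBigO.2
    ((boundedSignal_iff_isBigO.1 hf).sub (boundedSignal_iff_isBigO.1 hg))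

theorem smul {𝕜 : Type*} [NormedField 𝕜] [NormedSpace 𝕜 E] {u : ℝ → 𝕜}
    (hu : BoundedSignal u) (hf : BoundedSignal f) : BoundedSignal fun t => u t • f t := by
  rw [boundedSignal_iff_isBigO] at *
  simpa using hu.smul hf

theorem mul {𝕜 : Type*} [NormedField 𝕜] {u v : ℝ → 𝕜} (hu : BoundedSignal u)
    (hv : BoundedSignal v) : BoundedSignal fun t => u t * v t :=
  hu.smul hv

theorem sum {ι : Type*} {s : Finset ι} {f : ι → ℝ → E} (h : ∀ i ∈ s, BoundedSignal (f i)) :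
    BoundedSignal fun t => ∑ i ∈ s, f i t :=
  boundedSignal_iff_isBigO.2 (.fun_sum fun i hi => boundedSignal_iff_isBigO.1 (h i hi))

theorem pi_iff {ι : Type*} [Fintype ι] {f : ℝ → ι → E} :
    BoundedSignal f ↔ ∀ i, BoundedSignal fun t => f t i := by
  simp only [boundedSignal_iff_isBigO, Asymptotics.isBigO_pi]

theorem dotProduct {ι 𝕜 : Type*} [Fintype ι] [NormedField 𝕜] {u v : ℝ → ι → 𝕜}
    (hu : BoundedSignal u) (hv : BoundedSignal v) : BoundedSignal fun t => u t ⬝ᵥ v t :=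
  sum fun i _ => (pi_iff.1 hu i).mul (pi_iff.1 hv i)

theorem mulVec {ι κ : Type*} [Fintype ι] [Fintype κ] (M : Matrix κ ι ℝ) {z : ℝ → ι → ℝ}
    (hz : BoundedSignal z) : BoundedSignal fun t => M *ᵥ z t :=
  pi_iff.2 fun i => (const (M i)).dotProduct hz

theorem tendsto_smul_zero {𝕜 : Type*} [NormedField 𝕜] [NormedSpace 𝕜 E] {u : ℝ → 𝕜}
    (hf : BoundedSignal f) (hu : Tendsto u atTop (𝓝 0)) :
    Tendsto (fun t => u t • f t) atTop (𝓝 0) := by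
  obtain ⟨C, hC⟩ := hf
  exact hu.zero_smul_isBoundedUnder_le
    ⟨C, eventually_map.2 ((eventually_ge_atTop 0).mono hC)⟩

theorem of_sq_le {C : ℝ} (h : ∀ t, 0 ≤ t → ‖f t‖ ^ 2 ≤ C) : BoundedSignal f :=
  ⟨√C, fun t ht => Real.le_sqrt_of_sq_le (h t ht)⟩

theorem uniformContinuousOn_comp [ProperSpace E] {X : Type*} [UniformSpace X] {Φ : E → X}
    (hΦ : Continuous Φ) (hf : BoundedSignal f) (hfc : UniformContinuousOn f (Set.Ici 0)) :
    UniformContinuousOn (fun t => Φ (f t)) (Set.Ici 0) := by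
  obtain ⟨C, hC⟩ := hf
  exact ((isCompact_closedBall (0 : E) C).uniformContinuousOn_of_continuous
    hΦ.continuousOn).comp hfc fun t ht => mem_closedBall_zero_iff.2 (hC t ht)

theorem uniformContinuousOn_comp₂ [ProperSpace E] {E' X : Type*} [NormedAddCommGroup E']
    [ProperSpace E'] [UniformSpace X] {Φ : E × E' → X} (hΦ : Continuous Φ) {g : ℝ → E'}
    (hf : BoundedSignal f) (hfc : UniformContinuousOn f (Set.Ici 0))
    (hg : BoundedSignal g) (hgc : UniformContinuousOn g (Set.Ici 0)) :
    UniformContinuousOn (fun t => Φ (f t, g t)) (Set.Ici 0) := by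
  have hfg : BoundedSignal fun t => (f t, g t) := boundedSignal_iff_isBigO.2
    ((boundedSignal_iff_isBigO.1 hf).prod_left (boundedSignal_iff_isBigO.1 hg))
  refine hfg.uniformContinuousOn_comp hΦ ?_
  rw [uniformContinuousOn_iff_restrict] at *
  exact hfc.prodMk hgc

end BoundedSignal

end Bounded

section Barbalat

theorem DerivOnIci.eventually_lt_of_deriv_le {V V' g ρ : ℝ → ℝ} {ℓ : ℝ} (hV : DerivOnIci V V')
    (hlim : Tendsto V atTop (𝓝 ℓ)) (hle : ∀ t, 0 ≤ t → V' t ≤ -g t + ρ t)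
    (hρ : Tendsto ρ atTop (𝓝 0)) (hg : UniformContinuousOn g (Set.Ici 0)) {ε : ℝ} (hε : 0 < ε) :
    ∀ᶠ t in atTop, g t < ε := by
  obtain ⟨d, hd, hgd⟩ := Metric.uniformContinuousOn_iff.1 hg (ε / 4) (by positivity)
  have hincr : Tendsto (fun t => V (t + d / 2) - V t) atTop (𝓝 0) := by
    simpa using (hlim.comp (tendsto_atTop_add_const_right _ _ tendsto_id)).sub hlim
  have hρ' : ∀ᶠ t in atTop, ∀ s ≥ t, ρ s < ε / 4 :=
    eventually_forall_ge_atTop.2 (hρ.eventually_lt_const (by positivity))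
  filter_upwards [eventually_ge_atTop 0, hρ', hincr.eventually_const_lt
    (show -(ε / 2) * (d / 2) < 0 by nlinarith)] with t ht hρt hVt
  by_contra! hgt
  refine hVt.not_ge ?_
  -- If `g t ≥ ε`, then `g ≥ 3ε/4` on `[t, t + d/2]`, so `V` drops there by a fixed amount.
  have hdrop := hV.sub_le_mul_sub (c := -(ε / 2)) (t := t + d / 2) ht (by linarith)
    fun s hs => by
      have hs0 : 0 ≤ s := ht.trans hs.1
      have hclose := hgd s hs0 t ht (by
        rw [Real.dist_eq, abs_of_nonneg (sub_nonneg.2 hs.1)]; linarith [hs.2])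
      rw [Real.dist_eq, abs_lt] at hclose
      linarith [hle s hs0, hρt s hs.1]
  simpa using hdrop

theorem DerivOnIci.tendsto_zero_of_tendsto_deriv_sub {f f' g : ℝ → ℝ} {ℓ : ℝ}
    (hf : DerivOnIci f f') (hlim : Tendsto f atTop (𝓝 ℓ))
    (hfg : Tendsto (fun t => f' t - g t) atTop (𝓝 0)) (hg : UniformContinuousOn g (Set.Ici 0)) :
    Tendsto g atTop (𝓝 0) := by
  have hneg : UniformContinuousOn (fun t => -g t) (Set.Ici 0) :=
    uniformContinuous_neg.comp_uniformContinuousOn hg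
  rw [Metric.tendsto_nhds]
  intro ε hε
  filter_upwards [hf.neg.eventually_lt_of_deriv_le (ρ := fun t => -(f' t - g t)) hlim.neg
      (fun t _ => by linarith) (by simpa using hfg.neg) hg hε,
    hf.eventually_lt_of_deriv_le (ρ := fun t => f' t - g t) hlim (fun t _ => by linarith)
      hfg hneg hε] with t h₁ h₂
  rw [Real.dist_0_eq_abs, abs_lt]
  exact ⟨by linarith, h₁⟩

/-- Some nonnegative function decreases at a rate at least `‖f‖²`. This is how square
integrability of `f` on `[0, ∞)` is expressed here: no integral is needed. -/
def Dissipated {E : Type*} [Norm E] (f : ℝ → E) : Prop :=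
  ∃ U U' : ℝ → ℝ, DerivOnIci U U' ∧ ∀ t, 0 ≤ t → 0 ≤ U t ∧ U' t ≤ -‖f t‖ ^ 2

theorem Dissipated.tendsto_zero {E : Type*} [NormedAddCommGroup E] [ProperSpace E] {f : ℝ → E}
    (hf : Dissipated f) (hb : BoundedSignal f) (hc : UniformContinuousOn f (Set.Ici 0)) :
    Tendsto f atTop (𝓝 0) := by
  obtain ⟨U, U', hU, h⟩ := hf
  have hanti : AntitoneOn U (Set.Ici 0) :=
    hU.antitoneOn fun t ht => (h t ht).2.trans (neg_nonpos.2 (sq_nonneg _))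
  obtain ⟨ℓ, hℓ⟩ : ∃ ℓ, Tendsto (fun t => U (max t 0)) atTop (𝓝 ℓ) :=
    ⟨_, tendsto_atTop_ciInf
      (fun s t hst => hanti (le_max_right s 0) (le_max_right t 0) (max_le_max hst le_rfl))
      ⟨0, Set.forall_mem_range.2 fun t => (h _ (le_max_right t 0)).1⟩⟩
  have hlim : Tendsto U atTop (𝓝 ℓ) := hℓ.congr' <| by
    filter_upwards [eventually_ge_atTop 0] with t ht
    rw [max_eq_left ht]
  have hsq : UniformContinuousOn (fun t => ‖f t‖ ^ 2) (Set.Ici 0) :=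
    hb.uniformContinuousOn_comp (continuous_norm.pow 2) hc
  rw [NormedAddGroup.tendsto_nhds_zero]
  intro ε hε
  filter_upwards [hU.eventually_lt_of_deriv_le hlim (ρ := 0) (by simpa using fun t ht => (h t ht).2)
    tendsto_const_nhds hsq (pow_pos hε 2)] with t ht
  exact lt_of_pow_lt_pow_left₀ 2 hε.le ht

end Barbalat

section ScalarStability

variable {lam : ℂ} {w f : ℝ → ℂ}

theorem DerivOnIci.norm_sq_le (hlam : lam.re < 0) (hw : DerivOnIci w fun t => lam * w t + f t) :
    ∃ v' : ℝ → ℝ, DerivOnIci (fun t => ‖w t‖ ^ 2) v' ∧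
      ∀ t, v' t ≤ lam.re * ‖w t‖ ^ 2 - ‖f t‖ ^ 2 / lam.re := by
  refine ⟨_, fun t ht => (hw t ht).norm_sq, fun t => ?_⟩
  have hinner : inner ℝ (w t) (lam * w t) = lam.re * ‖w t‖ ^ 2 := by
    rw [Complex.sq_norm, Complex.normSq_apply]
    simp [Complex.inner]
    ring
  have hyoung : 2 * (‖w t‖ * ‖f t‖) ≤ -lam.re * ‖w t‖ ^ 2 - ‖f t‖ ^ 2 / lam.re := by
    have hsq : 0 ≤ (lam.re * ‖w t‖ + ‖f t‖) ^ 2 / -lam.re :=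
      div_nonneg (sq_nonneg _) (by linarith)
    have hexpand : (lam.re * ‖w t‖ + ‖f t‖) ^ 2 / -lam.re =
        -lam.re * ‖w t‖ ^ 2 - ‖f t‖ ^ 2 / lam.re - 2 * (‖w t‖ * ‖f t‖) := by
      field_simp [hlam.ne]
      ring
    linarith
  rw [inner_add_right, hinner]
  linarith [real_inner_le_norm (w t) (f t)]

theorem BoundedSignal.of_derivOnIci_mul_add (hlam : lam.re < 0)
    (hw : DerivOnIci w fun t => lam * w t + f t) (hf : BoundedSignal f) : BoundedSignal w := by
  obtain ⟨v', hv, hle⟩ := hw.norm_sq_le hlam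
  obtain ⟨C, hC⟩ := hf
  refine .of_sq_le fun t ht => hv.le_max (a := -lam.re) (c := C ^ 2 / lam.re ^ 2)
    (neg_pos.2 hlam) (fun x hx => (hle x).trans ?_) ht
  have hfC : ‖f x‖ ^ 2 / -lam.re ≤ C ^ 2 / -lam.re := by
    have := neg_pos.2 hlam
    gcongr
    exact hC x hx
  have hscale : lam.re * (C ^ 2 / lam.re ^ 2) = C ^ 2 / lam.re := by
    field_simp [hlam.ne]
  rw [div_neg, div_neg] at hfC
  linarith

theorem DerivOnIci.tendsto_zero_of_mul_add (hlam : lam.re < 0)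
    (hw : DerivOnIci w fun t => lam * w t + f t) (hf : Tendsto f atTop (𝓝 0)) :
    Tendsto w atTop (𝓝 0) := by
  obtain ⟨v', hv, hle⟩ := hw.norm_sq_le hlam
  rw [NormedAddGroup.tendsto_nhds_zero]
  intro ε hε
  have hsmall : ∀ᶠ t in atTop, -(‖f t‖ ^ 2 / lam.re) < -lam.re * (ε ^ 2 / 2) := by
    have : Tendsto (fun t => -(‖f t‖ ^ 2 / lam.re)) atTop (𝓝 0) := by
      simpa using ((hf.norm.pow 2).div_const lam.re).neg
    exact this.eventually_lt_const (by nlinarith [pow_pos hε 2])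
  filter_upwards [hv.eventually_lt (a := -lam.re) (c := ε ^ 2 / 2) (neg_pos.2 hlam)
    (hsmall.mono fun t ht => by linarith [hle t]) (half_pos (pow_pos hε 2))] with t ht
  exact lt_of_pow_lt_pow_left₀ 2 hε.le (by linarith)

theorem Dissipated.of_derivOnIci_mul_add (hlam : lam.re < 0)
    (hw : DerivOnIci w fun t => lam * w t + f t) (hf : Dissipated f) : Dissipated w := by
  obtain ⟨v', hv, hle⟩ := hw.norm_sq_le hlam
  obtain ⟨U, U', hU, hU'⟩ := hf
  have hinv : 0 < (-lam.re)⁻¹ := inv_pos.2 (neg_pos.2 hlam)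
  refine ⟨_, _, (hv.add (hU.const_mul (-lam.re)⁻¹)).const_mul (-lam.re)⁻¹, fun t ht => ⟨?_, ?_⟩⟩
  · have := (hU' t ht).1
    positivity
  · calc (-lam.re)⁻¹ * (v' t + (-lam.re)⁻¹ * U' t)
        ≤ (-lam.re)⁻¹ * (lam.re * ‖w t‖ ^ 2 - ‖f t‖ ^ 2 / lam.re + (-lam.re)⁻¹ * -‖f t‖ ^ 2) := by
          gcongr
          exacts [hle t, (hU' t ht).2]
      _ = -‖w t‖ ^ 2 := by
        field_simp [hlam.ne]
        ring

end ScalarStability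

section Modes

variable {n : ℕ} {F : Matrix (Fin n) (Fin n) ℝ} {z f : ℝ → Fin n → ℝ}

theorem HurwitzMatrix.re_lt_zero_of_mem_roots (hF : HurwitzMatrix F) {lam : ℂ}
    (hlam : lam ∈ (F.map (algebraMap ℝ ℂ)).charpoly.roots) : lam.re < 0 := by
  refine hF.2 lam ?_
  have hroot := (Polynomial.mem_roots'.1 hlam).2
  rwa [Matrix.charpoly_map, Polynomial.IsRoot.def, Polynomial.eval_map_algebraMap] at hroot

theorem aeval_prod_roots_charpoly_eq_zero {K : Type*} [Field K] [IsAlgClosed K]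
    (M : Matrix (Fin n) (Fin n) K) : Polynomial.aeval M
      ((M.charpoly.roots.map fun lam => Polynomial.X - Polynomial.C lam).prod) = 0 := by
  rw [← (IsAlgClosed.splits M.charpoly).eq_prod_roots_of_monic M.charpoly_monic]
  exact M.aeval_self_charpoly

theorem DerivOnIci.complex_dotProduct (hz : DerivOnIci z fun t => F *ᵥ z t + f t)
    (lam : ℂ) (a : Fin n → ℂ) :
    DerivOnIci (fun t => a ⬝ᵥ fun i => (z t i : ℂ)) fun t =>
      lam * (a ⬝ᵥ fun i => (z t i : ℂ)) +
        ((a ᵥ* (F.map (algebraMap ℝ ℂ) - lam • 1) ⬝ᵥ fun i => (z t i : ℂ)) +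
          a ⬝ᵥ fun i => (f t i : ℂ)) := by
  have hzc : DerivOnIci (fun t i => (z t i : ℂ)) fun t i => ((F *ᵥ z t + f t) i : ℂ) :=
    DerivOnIci.pi_iff.2 fun i => (DerivOnIci.pi_iff.1 hz i).clm_apply Complex.ofRealCLM
  refine (hzc.const_dotProduct a).congr_deriv fun t _ => ?_
  have hsplit : (fun i => ((F *ᵥ z t + f t) i : ℂ)) =
      F.map (algebraMap ℝ ℂ) *ᵥ (fun i => (z t i : ℂ)) + fun i => (f t i : ℂ) := by
    ext i
    simp [Matrix.mulVec, dotProduct]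
  rw [hsplit, dotProduct_add, ← Matrix.dotProduct_mulVec, Matrix.sub_mulVec, Matrix.smul_mulVec,
    Matrix.one_mulVec, dotProduct_sub, dotProduct_smul, smul_eq_mul]
  ring

/- By Cayley–Hamilton the functionals `a ∏ (F - λᵢ)` of the state reach zero after finitely many
factors, and each of them is driven through the stable mode `λᵢ` by the next one. -/
theorem HurwitzMatrix.mode_induction (hF : HurwitzMatrix F)
    (hz : DerivOnIci z fun t => F *ᵥ z t + f t) {Q : (ℝ → ℂ) → Prop} (zero : Q fun _ => 0)
    (mode : ∀ (lam : ℂ) (a : Fin n → ℂ) (w w₁ : ℝ → ℂ), lam.re < 0 →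
      DerivOnIci w (fun t => lam * w t + (w₁ t + a ⬝ᵥ fun i => (f t i : ℂ))) → Q w₁ → Q w)
    (a : Fin n → ℂ) : Q fun t => a ⬝ᵥ fun i => (z t i : ℂ) := by
  suffices hind : ∀ s : Multiset ℂ, (∀ lam ∈ s, lam.re < 0) → ∀ a : Fin n → ℂ,
      a ᵥ* Polynomial.aeval (F.map (algebraMap ℝ ℂ))
        ((s.map fun lam => Polynomial.X - Polynomial.C lam).prod) = 0 →
      Q fun t => a ⬝ᵥ fun i => (z t i : ℂ) from
    hind _ (fun _ => hF.re_lt_zero_of_mem_roots) a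
      (by rw [aeval_prod_roots_charpoly_eq_zero, Matrix.vecMul_zero])
  intro s
  induction s using Multiset.induction_on with
  | empty =>
    intro _ a ha
    simp only [Multiset.map_zero, Multiset.prod_zero, map_one, Matrix.vecMul_one] at ha
    simpa only [ha, zero_dotProduct] using zero
  | cons lam s ih =>
    intro hs a ha
    have hfactor : Polynomial.aeval (F.map (algebraMap ℝ ℂ)) (Polynomial.X - Polynomial.C lam) =
        F.map (algebraMap ℝ ℂ) - lam • 1 := by
      simp [Algebra.algebraMap_eq_smul_one]
    rw [Multiset.map_cons, Multiset.prod_cons, map_mul, ← Matrix.vecMul_vecMul, hfactor] at ha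
    exact mode lam a _ _ (hs lam (Multiset.mem_cons_self _ _)) (hz.complex_dotProduct lam a)
      (ih (fun x hx => hs x (Multiset.mem_cons_of_mem hx)) _ ha)

theorem HurwitzMatrix.boundedSignal (hF : HurwitzMatrix F)
    (hz : DerivOnIci z fun t => F *ᵥ z t + f t) (hf : BoundedSignal f) : BoundedSignal z := by
  have hfc : BoundedSignal fun t i => (f t i : ℂ) := BoundedSignal.pi_iff.2 fun i => by
    simpa only [BoundedSignal, Complex.norm_real] using BoundedSignal.pi_iff.1 hf i
  have hfunctional := hF.mode_induction hz (Q := BoundedSignal) (.const 0)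
    fun lam a w w₁ hlam hw hw₁ =>
      .of_derivOnIci_mul_add hlam hw (hw₁.add ((BoundedSignal.const a).dotProduct hfc))
  refine BoundedSignal.pi_iff.2 fun i => ?_
  simpa [BoundedSignal] using hfunctional (Pi.single i 1)

theorem HurwitzMatrix.tendsto_zero (hF : HurwitzMatrix F)
    (hz : DerivOnIci z fun t => F *ᵥ z t + f t) (hf : Tendsto f atTop (𝓝 0)) :
    Tendsto z atTop (𝓝 0) := by
  have hfc : ∀ a : Fin n → ℂ, Tendsto (fun t => a ⬝ᵥ fun i => (f t i : ℂ)) atTop (𝓝 0) :=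
    fun a => by
      have hcont : Continuous fun x : Fin n → ℝ => a ⬝ᵥ fun i => (x i : ℂ) := by fun_prop
      simpa [dotProduct, Function.comp_def] using (hcont.tendsto 0).comp hf
  have hfunctional := hF.mode_induction hz (Q := fun w => Tendsto w atTop (𝓝 0))
    tendsto_const_nhds fun lam a w w₁ hlam hw hw₁ =>
      hw.tendsto_zero_of_mul_add hlam (by simpa using hw₁.add (hfc a))
  refine tendsto_pi_nhds.2 fun i => ?_
  simpa [Function.comp_def] using
    (Complex.continuous_re.tendsto _).comp (hfunctional (Pi.single i 1))

theorem HurwitzMatrix.dissipated_dotProduct (hF : HurwitzMatrix F)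
    (hz : DerivOnIci z fun t => F *ᵥ z t) (a : Fin n → ℝ) : Dissipated fun t => a ⬝ᵥ z t := by
  have hz' : DerivOnIci z fun t => F *ᵥ z t + (0 : Fin n → ℝ) :=
    hz.congr_deriv fun t _ => (add_zero _).symm
  have hzero : Dissipated fun _ : ℝ => (0 : ℂ) :=
    ⟨fun _ => 0, fun _ => 0, DerivOnIci.const 0, fun t _ => by simp⟩
  have hfunctional := hF.mode_induction hz' hzero fun lam a w w₁ hlam hw hw₁ =>
    .of_derivOnIci_mul_add hlam (hw.congr_deriv fun t _ => by simp [dotProduct]) hw₁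
  have hcast : ∀ t, ((fun i => (a i : ℂ)) ⬝ᵥ fun i => (z t i : ℂ)) = ((a ⬝ᵥ z t : ℝ) : ℂ) :=
    fun t => by simp [dotProduct]
  simpa only [hcast, Dissipated, Complex.norm_real] using hfunctional fun i => (a i : ℂ)

end Modes

section Transfer

open Polynomial

variable {n : ℕ} (F : Matrix (Fin n) (Fin n) ℝ) (b : Fin n → ℝ)

/-- The numerator `aᵀ adj(p I - F) b` of `aᵀ (p I - F)⁻¹ b` over the characteristic polynomial
of `F`, before any cancellation. -/
noncomputable def numer (a : Fin n → ℝ) : ℝ[X] :=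
  (fun i => C (a i)) ⬝ᵥ (F.charmatrix.adjugate *ᵥ fun i => C (b i))

theorem charmatrix_eq_smul_one_sub :
    F.charmatrix = (X : ℝ[X]) • (1 : Matrix (Fin n) (Fin n) ℝ[X]) - F.map C := by
  rw [Matrix.charmatrix, Matrix.smul_one_eq_diagonal]
  rfl

theorem transferFn_eq_numer_div (a : Fin n → ℝ) :
    transferFn F b a 0 =
      algebraMap ℝ[X] (RatFunc ℝ) (numer F b a) / algebraMap ℝ[X] (RatFunc ℝ) F.charpoly := by
  set φ := algebraMap ℝ[X] (RatFunc ℝ)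
  have hchar : (RatFunc.X : RatFunc ℝ) • (1 : Matrix (Fin n) (Fin n) (RatFunc ℝ)) -
      F.map RatFunc.C = φ.mapMatrix F.charmatrix := by
    ext i j
    by_cases hij : i = j <;> simp [charmatrix_eq_smul_one_sub, φ, hij]
  have hdet : (φ.mapMatrix F.charmatrix).det = φ F.charpoly := (φ.map_det _).symm
  have hnumer : φ (numer F b a) = (fun i => RatFunc.C (a i)) ⬝ᵥ
      (φ.mapMatrix F.charmatrix.adjugate *ᵥ fun i => RatFunc.C (b i)) := by
    simp [numer, dotProduct, Matrix.mulVec, φ, map_sum]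
  rw [transferFn, hchar, Matrix.inv_def, ← φ.map_adjugate, hdet, Ring.inverse_eq_inv',
    Matrix.smul_mulVec, dotProduct_smul, map_zero, add_zero, smul_eq_mul, ← hnumer,
    div_eq_inv_mul]

theorem numer_smul (s : ℝ) (a : Fin n → ℝ) : numer F b (s • a) = C s * numer F b a := by
  simp only [numer, dotProduct, Pi.smul_apply, smul_eq_mul, C_mul, mul_assoc, Finset.mul_sum]

theorem numer_shift (a : Fin n → ℝ) (s : ℝ) :
    numer F b (Fᵀ *ᵥ a + s • a) = (X + C s) * numer F b a - C (a ⬝ᵥ b) * F.charpoly := by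
  have hadj : F.map C * F.charmatrix.adjugate =
      (X : ℝ[X]) • F.charmatrix.adjugate - F.charpoly • (1 : Matrix (Fin n) (Fin n) ℝ[X]) := by
    have hmul := F.charmatrix.mul_adjugate
    nth_rw 1 [charmatrix_eq_smul_one_sub] at hmul
    rw [Matrix.sub_mul, Matrix.smul_mul, Matrix.one_mul] at hmul
    exact eq_sub_of_add_eq (sub_eq_iff_eq_add'.1 hmul).symm
  have hrow : (fun i => C ((Fᵀ *ᵥ a + s • a) i)) =
      (fun i => C (a i)) ᵥ* F.map C + C s • fun i => C (a i) := by
    ext1 i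
    simp [Matrix.mulVec, Matrix.vecMul, dotProduct, mul_comm]
  have hab : C (a ⬝ᵥ b) = (fun i => C (a i)) ⬝ᵥ fun i => C (b i) := by
    simp [dotProduct]
  unfold numer
  rw [hrow, add_dotProduct, ← Matrix.dotProduct_mulVec, Matrix.mulVec_mulVec, hadj,
    Matrix.sub_mulVec, Matrix.smul_mulVec, Matrix.smul_mulVec, Matrix.one_mulVec, dotProduct_sub,
    dotProduct_smul, dotProduct_smul, smul_dotProduct, hab]
  simp only [smul_eq_mul]
  ring

theorem det_add_vecMulVec_of_isUnit {ι R : Type*} [Fintype ι] [DecidableEq ι] [CommRing R]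
    {A : Matrix ι ι R} (hA : IsUnit A.det) (u v : ι → R) :
    (A + vecMulVec u v).det = A.det + v ⬝ᵥ (A.adjugate *ᵥ u) := by
  rw [vecMulVec_eq Unit, det_add_replicateCol_mul_replicateRow hA, det_unique (n := Unit),
    Matrix.add_apply, Matrix.one_apply_eq, Matrix.mul_assoc, ← replicateCol_mulVec,
    replicateRow_mul_replicateCol_apply, mul_add, mul_one, ← smul_eq_mul A.det (v ⬝ᵥ _),
    ← dotProduct_smul, ← Matrix.smul_mulVec, Matrix.inv_def, smul_smul,
    Ring.mul_inverse_cancel _ hA, one_smul]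

theorem det_add_vecMulVec {ι R : Type*} [Fintype ι] [DecidableEq ι] [CommRing R] [IsDomain R]
    {A : Matrix ι ι R} (hA : A.det ≠ 0) (u v : ι → R) :
    (A + vecMulVec u v).det = A.det + v ⬝ᵥ (A.adjugate *ᵥ u) := by
  have hinj := IsFractionRing.injective R (FractionRing R)
  set φ := algebraMap R (FractionRing R)
  have hmap : φ.mapMatrix A + vecMulVec (fun i => φ (u i)) (fun i => φ (v i)) =
      φ.mapMatrix (A + vecMulVec u v) := by
    ext i j
    simp [vecMulVec_apply]
  have hdet := det_add_vecMulVec_of_isUnit (A := φ.mapMatrix A)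
    (by rw [← RingHom.map_det]; exact isUnit_iff_ne_zero.2 ((map_ne_zero_iff _ hinj).2 hA))
    (fun i => φ (u i)) (fun i => φ (v i))
  rw [hmap, ← RingHom.map_det, ← RingHom.map_det, ← RingHom.map_adjugate] at hdet
  refine hinj (hdet.trans ?_)
  simp [dotProduct, Matrix.mulVec, map_sum]

theorem charpoly_sub_vecMulVec (a : Fin n → ℝ) :
    (F - vecMulVec b a).charpoly = F.charpoly + numer F b a := by
  have hchar : (F - vecMulVec b a).charmatrix =
      F.charmatrix + vecMulVec (fun i => C (b i)) (fun i => C (a i)) := by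
    ext1 i j
    simp only [charmatrix_eq_smul_one_sub, Matrix.sub_apply, Matrix.add_apply, vecMulVec_apply,
      Matrix.map_apply, C_sub, C_mul]
    ring
  rw [Matrix.charpoly, hchar, det_add_vecMulVec F.charpoly_monic.ne_zero]
  rfl

theorem degree_numer_lt (a : Fin n → ℝ) : (numer F b a).degree < n := by
  have hdeg : ∀ M : Matrix (Fin n) (Fin n) ℝ, M.charpoly.degree = n := fun M => by
    rw [Matrix.charpoly_degree_eq_dim, Fintype.card_fin]
  have hmonic := (F - vecMulVec b a).charpoly_monic
  rw [← hdeg (F - vecMulVec b a), eq_sub_of_add_eq' (charpoly_sub_vecMulVec F b a).symm]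
  exact degree_sub_lt_left ((hdeg _).trans (hdeg F).symm) hmonic.ne_zero
    (hmonic.leadingCoeff.trans F.charpoly_monic.leadingCoeff.symm)

variable (c : Fin n → ℝ) (lam : ℝ)

/-- The rows `cᵀ (F + lam I) ^ j`, whose products with `b` are the Markov parameters of
`cᵀ (p I - F)⁻¹ b` in powers of `p + lam`. -/
noncomputable def shiftedRow : ℕ → Fin n → ℝ
  | 0 => c
  | j + 1 => Fᵀ *ᵥ shiftedRow j + lam • shiftedRow j

variable {F b c lam} in
theorem numer_shiftedRow {j : ℕ} (h : ∀ i < j, shiftedRow F c lam i ⬝ᵥ b = 0) :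
    numer F b (shiftedRow F c lam j) = (X + C lam) ^ j * numer F b c := by
  induction j with
  | zero => simp [shiftedRow]
  | succ j ih =>
    rw [shiftedRow, numer_shift, ih fun i hi => h i (hi.trans j.lt_succ_self),
      h j j.lt_succ_self, C_0, zero_mul, sub_zero, pow_succ']
    ring

variable {F b c} in
theorem exists_shiftedRow_dotProduct_ne_zero (h : numer F b c ≠ 0) :
    ∃ ρ, (∀ i < ρ, shiftedRow F c lam i ⬝ᵥ b = 0) ∧ shiftedRow F c lam ρ ⬝ᵥ b ≠ 0 := by
  have hex : ∃ j, shiftedRow F c lam j ⬝ᵥ b ≠ 0 := by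
    by_contra! hall
    have hlt := degree_numer_lt F b (shiftedRow F c lam n)
    rw [numer_shiftedRow fun i _ => hall i, degree_mul, degree_pow, degree_X_add_C,
      degree_eq_natDegree h, nsmul_one] at hlt
    exact absurd hlt (not_lt.2 (le_add_of_nonneg_right (Nat.cast_nonneg' _)))
  classical
  exact ⟨Nat.find hex, fun i hi => not_not.1 (Nat.find_min hex hi), Nat.find_spec hex⟩

variable {F b c}

theorem hurwitzPoly_numer (hF : HurwitzMatrix F) (hmp : MinimumPhase (transferFn F b c 0)) :
    HurwitzPoly (numer F b c) := by
  have hdiv := transferFn_eq_numer_div F b c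
  refine ⟨fun h0 => hmp.1 ?_, fun z hz => ?_⟩
  · rw [hdiv, h0, map_zero, zero_div, RatFunc.num_zero]
  · have hcross := congrArg (aeval z)
      ((RatFunc.num_mul_eq_mul_denom_iff F.charpoly_monic.ne_zero).2 hdiv)
    rw [map_mul, map_mul, hz, zero_mul, mul_eq_zero] at hcross
    exact hcross.elim (hmp.2 z) (hF.2 z)

variable {lam}

/- The feedback makes `(p + lam)^(ρ + 1) H` an output equal to `κ u`; eliminating `u` moves the
eigenvalues of `F` to the zeros of that output. -/
theorem hurwitzMatrix_inverse (hF : HurwitzMatrix F) (hmp : MinimumPhase (transferFn F b c 0))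
    (hlam : 0 < lam) {ρ : ℕ} (h0 : ∀ i < ρ, shiftedRow F c lam i ⬝ᵥ b = 0)
    (hκ : shiftedRow F c lam ρ ⬝ᵥ b ≠ 0) :
    HurwitzMatrix (F - vecMulVec b
      ((shiftedRow F c lam ρ ⬝ᵥ b)⁻¹ • shiftedRow F c lam (ρ + 1))) := by
  set κ := shiftedRow F c lam ρ ⬝ᵥ b with hκdef
  have hχ : (F - vecMulVec b (κ⁻¹ • shiftedRow F c lam (ρ + 1))).charpoly =
      C κ⁻¹ * ((X + C lam) ^ (ρ + 1) * numer F b c) := by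
    have hκκ : C κ⁻¹ * C κ = 1 := by rw [← C_mul, inv_mul_cancel₀ hκ, C_1]
    rw [charpoly_sub_vecMulVec, numer_smul, shiftedRow, numer_shift, numer_shiftedRow h0, ← hκdef]
    linear_combination (-F.charpoly) * hκκ
  refine ⟨(Matrix.charpoly_monic _).ne_zero, fun z hz => ?_⟩
  rw [hχ] at hz
  simp only [map_mul, map_pow, map_add, aeval_X, aeval_C, mul_eq_zero] at hz
  rcases hz with hz | hz | hz
  · exact absurd hz (by simpa using hκ)
  · rw [eq_neg_of_add_eq_zero_left (eq_zero_of_pow_eq_zero hz)]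
    simpa using hlam
  · exact (hurwitzPoly_numer hF hmp).2 z hz

theorem dotProduct_inv_mulVec_of_transferFn_eq {α : ℝ[X]} (hα : α.eval 0 ≠ 0)
    (hF : IsUnit F.det)
    (h : transferFn F b c 0 = RatFunc.C (α.eval 0) / algebraMap ℝ[X] (RatFunc ℝ) α) :
    c ⬝ᵥ (F⁻¹ *ᵥ b) = -1 := by
  have hα0 : α ≠ 0 := by
    rintro rfl
    exact hα eval_zero
  have hcross : numer F b c * α = C (α.eval 0) * F.charpoly := by
    rw [transferFn_eq_numer_div, ← RatFunc.algebraMap_C,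
      div_eq_div_iff (RatFunc.algebraMap_ne_zero F.charpoly_monic.ne_zero)
        (RatFunc.algebraMap_ne_zero hα0), ← map_mul, ← map_mul] at h
    exact RatFunc.algebraMap_injective ℝ h
  have hshift : numer F b c = X * numer F b (c ᵥ* F⁻¹) - C (c ⬝ᵥ (F⁻¹ *ᵥ b)) * F.charpoly := by
    have := numer_shift F b (c ᵥ* F⁻¹) 0
    rwa [Matrix.mulVec_transpose, Matrix.vecMul_vecMul, Matrix.nonsing_inv_mul _ hF,
      Matrix.vecMul_one, zero_smul, add_zero, C_0, add_zero, ← Matrix.dotProduct_mulVec] at this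
  have hχ : F.charpoly.eval 0 ≠ 0 := fun h0 => hF.ne_zero <| by
    rw [Matrix.det_eq_sign_charpoly_coeff, coeff_zero_eq_eval_zero, h0, mul_zero]
  have heval := congrArg (eval 0) hcross
  rw [hshift] at heval
  simp only [eval_mul, eval_sub, eval_X, eval_C, zero_mul, zero_sub] at heval
  refine mul_right_cancel₀ (mul_ne_zero hα hχ) ?_
  linear_combination -heval

theorem HurwitzPoly.eval_zero_ne_zero {α : ℝ[X]} (hα : HurwitzPoly α) : α.eval 0 ≠ 0 := by
  intro h0
  refine (hα.2 0 ?_).ne Complex.zero_re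
  rw [← map_zero (algebraMap ℝ ℂ), aeval_algebraMap_apply, coe_aeval_eq_eval, h0, map_zero]

end Transfer

/-- Signals with `k` bounded derivatives on `[0, ∞)`: the class on which the inverse of a filter
of relative degree `k` acts without differentiating unbounded quantities. -/
def SmoothBounded {E : Type*} [NormedAddCommGroup E] [NormedSpace ℝ E] :
    ℕ → (ℝ → E) → Prop
  | 0, f => BoundedSignal f
  | k + 1, f => BoundedSignal f ∧ ∃ f', DerivOnIci f f' ∧ SmoothBounded k f'

namespace SmoothBounded

variable {E F ι : Type*} [NormedAddCommGroup E] [NormedSpace ℝ E] [NormedAddCommGroup F]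
  [NormedSpace ℝ F] {k j : ℕ} {f g : ℝ → E}

theorem boundedSignal (h : SmoothBounded k f) : BoundedSignal f := by
  cases k with
  | zero => exact h
  | succ k => exact h.1

theorem of_succ (h : SmoothBounded (k + 1) f) : SmoothBounded k f := by
  induction k generalizing f with
  | zero => exact h.1
  | succ k ih =>
    obtain ⟨hb, f', hf', hsmooth⟩ := h
    exact ⟨hb, f', hf', ih hsmooth⟩

theorem uniformContinuousOn (h : SmoothBounded (k + 1) f) :
    UniformContinuousOn f (Set.Ici 0) := by
  obtain ⟨-, f', hf', h'⟩ := h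
  exact hf'.uniformContinuousOn h'.boundedSignal

theorem mono (h : SmoothBounded k f) (hj : j ≤ k) : SmoothBounded j f := by
  induction k, hj using Nat.le_induction with
  | base => exact h
  | succ k _ ih => exact ih h.of_succ

theorem congr (h : SmoothBounded k f) (hg : ∀ t, 0 ≤ t → g t = f t) : SmoothBounded k g := by
  cases k with
  | zero => exact BoundedSignal.congr h hg
  | succ k =>
    obtain ⟨hb, f', hf', hsmooth⟩ := h
    exact ⟨hb.congr hg, f', hf'.congr hg, hsmooth⟩

theorem const (k : ℕ) (c : E) : SmoothBounded k fun _ => c := by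
  induction k generalizing c with
  | zero => exact BoundedSignal.const c
  | succ k ih => exact ⟨.const c, _, .const c, ih 0⟩

theorem add (hf : SmoothBounded k f) (hg : SmoothBounded k g) :
    SmoothBounded k fun t => f t + g t := by
  induction k generalizing f g with
  | zero => exact BoundedSignal.add hf hg
  | succ k ih =>
    obtain ⟨hfb, f', hf', hf⟩ := hf
    obtain ⟨hgb, g', hg', hg⟩ := hg
    exact ⟨hfb.add hgb, _, hf'.add hg', ih hf hg⟩

theorem smul {u : ℝ → ℝ} (hu : SmoothBounded k u) (hf : SmoothBounded k f) :
    SmoothBounded k fun t => u t • f t := by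
  induction k generalizing u f with
  | zero => exact BoundedSignal.smul hu hf
  | succ k ih =>
    have hu_k := hu.of_succ
    have hf_k := hf.of_succ
    obtain ⟨hub, u', hu', hu⟩ := hu
    obtain ⟨hfb, f', hf', hf⟩ := hf
    exact ⟨hub.smul hfb, _, hu'.smul hf', (ih hu_k hf).add (ih hu hf_k)⟩

theorem sub (hf : SmoothBounded k f) (hg : SmoothBounded k g) :
    SmoothBounded k fun t => f t - g t := by
  simpa only [neg_one_smul, ← sub_eq_add_neg] using hf.add ((const k (-1 : ℝ)).smul hg)

theorem sum {s : Finset ι} {f : ι → ℝ → E} (h : ∀ i ∈ s, SmoothBounded k (f i)) :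
    SmoothBounded k fun t => ∑ i ∈ s, f i t := by
  classical
  induction s using Finset.induction_on with
  | empty => simpa using const k 0
  | insert a s ha ih =>
    simp only [Finset.sum_insert ha]
    exact (h a (Finset.mem_insert_self _ _)).add
      (ih fun i hi => h i (Finset.mem_insert_of_mem hi))

theorem clm_apply (L : E →L[ℝ] F) (hf : SmoothBounded k f) : SmoothBounded k fun t => L (f t) := by
  induction k generalizing f with
  | zero =>
    obtain ⟨C, hC⟩ := hf
    exact ⟨‖L‖ * C, fun t ht => L.le_opNorm_of_le (hC t ht)⟩
  | succ k ih =>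
    have hLb := (ih hf.of_succ).boundedSignal
    obtain ⟨-, f', hf', hf⟩ := hf
    exact ⟨hLb, _, hf'.clm_apply L, ih hf⟩

variable [Fintype ι]

theorem pi_iff {f : ℝ → ι → E} : SmoothBounded k f ↔ ∀ i, SmoothBounded k fun t => f t i := by
  classical
  refine ⟨fun h i => h.clm_apply (ContinuousLinearMap.proj (R := ℝ) (φ := fun _ : ι => E) i),
    fun h => ?_⟩
  have hsingle : f = fun t => ∑ i, Pi.single i (f t i) :=
    funext fun t => (Finset.univ_sum_single (f t)).symm
  rw [hsingle]
  exact sum fun i _ => (h i).clm_apply (ContinuousLinearMap.single ℝ (fun _ : ι => E) i)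

theorem dotProduct {u v : ℝ → ι → ℝ} (hu : SmoothBounded k u) (hv : SmoothBounded k v) :
    SmoothBounded k fun t => u t ⬝ᵥ v t :=
  sum fun i _ => (pi_iff.1 hu i).smul (pi_iff.1 hv i)

theorem mulVec {κ : Type*} [Fintype κ] (M : Matrix κ ι ℝ) {z : ℝ → ι → ℝ}
    (hz : SmoothBounded k z) : SmoothBounded k fun t => M *ᵥ z t :=
  pi_iff.2 fun i => (const k (M i)).dotProduct hz

theorem of_derivOnIci_clm_add (L : E →L[ℝ] E) {z : ℝ → E} (hb : BoundedSignal z)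
    (hz : DerivOnIci z fun t => L (z t) + f t) (hf : SmoothBounded k f) :
    SmoothBounded (k + 1) z := by
  induction k with
  | zero => exact ⟨hb, _, hz, (clm_apply (k := 0) L hb).add hf⟩
  | succ k ih => exact ⟨hb, _, hz, ((ih hf.of_succ).clm_apply L).add hf⟩

theorem of_derivOnIci_mulVec {M : Matrix ι ι ℝ} {z : ℝ → ι → ℝ}
    (hb : BoundedSignal z) (hz : DerivOnIci z fun t => M *ᵥ z t) (k : ℕ) : SmoothBounded k z :=
  (of_derivOnIci_clm_add M.mulVecLin.toContinuousLinearMap hb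
    (hz.congr_deriv fun _ _ => (add_zero _).symm) (const k 0)).of_succ

end SmoothBounded

theorem tendsto_const_dotProduct_zero {ι τ : Type*} [Fintype ι] {l : Filter τ} {v : τ → ι → ℝ}
    (a : ι → ℝ) (hv : Tendsto v l (𝓝 0)) : Tendsto (fun t => a ⬝ᵥ v t) l (𝓝 0) := by
  have hcont : Continuous fun w : ι → ℝ => a ⬝ᵥ w := by fun_prop
  simpa [Function.comp_def] using (hcont.tendsto 0).comp hv

section FilterChain

variable {n ρ : ℕ} {F : Matrix (Fin n) (Fin n) ℝ} {b c : Fin n → ℝ} {lam : ℝ}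
  {z d : ℝ → Fin n → ℝ} {u : ℝ → ℝ}

/-- The signal `(p + lam)ʲ⁺¹ cᵀ (p I - F)⁻¹ b [u]`, read off the state `z` of the filter; this
reading is correct as long as the relative degree of the filter exceeds `j`. -/
noncomputable def chainOutput (F : Matrix (Fin n) (Fin n) ℝ) (b c : Fin n → ℝ) (lam : ℝ)
    (z : ℝ → Fin n → ℝ) (u : ℝ → ℝ) (j : ℕ) (t : ℝ) : ℝ :=
  shiftedRow F c lam (j + 1) ⬝ᵥ z t + (shiftedRow F c lam j ⬝ᵥ b) * u t

theorem derivOnIci_chainOutput (hz : DerivOnIci z fun t => F *ᵥ z t + u t • b + d t) {j : ℕ}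
    (hj : shiftedRow F c lam j ⬝ᵥ b = 0) :
    DerivOnIci (chainOutput F b c lam z u j) fun t =>
      chainOutput F b c lam z u (j + 1) t - lam * chainOutput F b c lam z u j t +
        shiftedRow F c lam (j + 1) ⬝ᵥ d t := by
  have hread : ∀ t, chainOutput F b c lam z u j t = shiftedRow F c lam (j + 1) ⬝ᵥ z t :=
    fun t => by rw [chainOutput, hj, zero_mul, add_zero]
  refine ((hz.const_dotProduct (shiftedRow F c lam (j + 1))).congr fun t _ =>
    hread t).congr_deriv fun t _ => ?_
  rw [hread t, chainOutput, shiftedRow.eq_2 F c lam (j + 1), add_dotProduct, dotProduct_add,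
    dotProduct_add, dotProduct_smul, smul_dotProduct, Matrix.mulVec_transpose,
    ← Matrix.dotProduct_mulVec]
  simp only [smul_eq_mul]
  ring

theorem BoundedSignal.chainOutput (hz : BoundedSignal z) (hu : BoundedSignal u) (j : ℕ) :
    BoundedSignal (chainOutput F b c lam z u j) :=
  ((BoundedSignal.const _).dotProduct hz).add ((BoundedSignal.const _).mul hu)

theorem smoothBounded_chainOutput (hz : DerivOnIci z fun t => F *ᵥ z t + u t • b)
    (h0 : ∀ i < ρ, shiftedRow F c lam i ⬝ᵥ b = 0) (hzb : BoundedSignal z)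
    (hub : BoundedSignal u) (k j : ℕ) (hkj : j + k = ρ) :
    SmoothBounded k (chainOutput F b c lam z u j) := by
  induction k generalizing j with
  | zero => exact hzb.chainOutput hub j
  | succ k ih =>
    have hderiv := derivOnIci_chainOutput (d := 0)
      (hz.congr_deriv fun t _ => (add_zero _).symm) (h0 j (by omega))
    refine .of_derivOnIci_clm_add (-lam • .id ℝ ℝ) (hzb.chainOutput hub j)
      (hderiv.congr_deriv fun t _ => ?_) (ih (j + 1) (by omega))
    simp
    ring

theorem SmoothBounded.chainOutput_of_output (hz : DerivOnIci z fun t => F *ᵥ z t + u t • b)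
    (h0 : ∀ i < ρ, shiftedRow F c lam i ⬝ᵥ b = 0)
    (hv : SmoothBounded ρ (chainOutput F b c lam z u 0)) (k j : ℕ) (hkj : j + k = ρ) :
    SmoothBounded k (chainOutput F b c lam z u j) := by
  induction j generalizing k with
  | zero => exact hv.mono (by omega)
  | succ j ih =>
    have hsmooth := ih (k + 1) (by omega)
    obtain ⟨-, f', hf', hsmooth'⟩ := id hsmooth
    have hderiv := derivOnIci_chainOutput (d := 0)
      (hz.congr_deriv fun t _ => (add_zero _).symm) (h0 j (by omega))
    refine (hsmooth'.add ((const k lam).smul hsmooth.of_succ)).congr fun t ht => ?_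
    simp [hf'.unique hderiv ht]

theorem derivOnIci_inverse (hz : DerivOnIci z fun t => F *ᵥ z t + u t • b + d t)
    (hκ : shiftedRow F c lam ρ ⬝ᵥ b ≠ 0) :
    DerivOnIci z fun t => (F - vecMulVec b
      ((shiftedRow F c lam ρ ⬝ᵥ b)⁻¹ • shiftedRow F c lam (ρ + 1))) *ᵥ z t +
      (((shiftedRow F c lam ρ ⬝ᵥ b)⁻¹ * chainOutput F b c lam z u ρ t) • b + d t) := by
  refine hz.congr_deriv fun t _ => ?_
  rw [Matrix.sub_mulVec, Matrix.vecMulVec_mulVec, op_smul_eq_smul, smul_dotProduct, smul_eq_mul,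
    chainOutput, mul_add, inv_mul_cancel_left₀ hκ, add_smul]
  abel

theorem input_eq_of_chainOutput (hκ : shiftedRow F c lam ρ ⬝ᵥ b ≠ 0) (t : ℝ) :
    u t = (shiftedRow F c lam ρ ⬝ᵥ b)⁻¹ *
      (chainOutput F b c lam z u ρ t - shiftedRow F c lam (ρ + 1) ⬝ᵥ z t) := by
  rw [chainOutput, add_sub_cancel_left, inv_mul_cancel_left₀ hκ]

theorem boundedSignal_of_smoothBounded_output (hF : HurwitzMatrix F)
    (hmp : MinimumPhase (transferFn F b c 0)) (hlam : 0 < lam)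
    (h0 : ∀ i < ρ, shiftedRow F c lam i ⬝ᵥ b = 0) (hκ : shiftedRow F c lam ρ ⬝ᵥ b ≠ 0)
    (hz : DerivOnIci z fun t => F *ᵥ z t + u t • b)
    (hv : SmoothBounded ρ (chainOutput F b c lam z u 0)) :
    BoundedSignal u ∧ BoundedSignal z := by
  have hY : BoundedSignal (chainOutput F b c lam z u ρ) := hv.chainOutput_of_output hz h0 0 ρ rfl
  have hzb : BoundedSignal z :=
    (hurwitzMatrix_inverse hF hmp hlam h0 hκ).boundedSignal
      (derivOnIci_inverse (d := 0) (hz.congr_deriv fun t _ => (add_zero _).symm) hκ)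
      ((((BoundedSignal.const _).mul hY).smul (.const b)).add (.const 0))
  refine ⟨?_, hzb⟩
  exact ((BoundedSignal.const _).mul (hY.sub ((BoundedSignal.const _).dotProduct hzb))).congr
    fun t _ => input_eq_of_chainOutput hκ t

/- Barbalat's lemma propagates `Y j → 0` to `Y (j + 1) → 0`, since `(Y j)' = Y (j + 1) + o(1)`;
the last `Y ρ` drives the stable inverse filter. -/
theorem tendsto_input_zero (hF : HurwitzMatrix F)
    (hmp : MinimumPhase (transferFn F b c 0)) (hlam : 0 < lam)
    (h0 : ∀ i < ρ, shiftedRow F c lam i ⬝ᵥ b = 0) (hκ : shiftedRow F c lam ρ ⬝ᵥ b ≠ 0)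
    (hz : DerivOnIci z fun t => F *ᵥ z t + u t • b + d t) (hd : Tendsto d atTop (𝓝 0))
    (hY : ∀ j, UniformContinuousOn (chainOutput F b c lam z u j) (Set.Ici 0))
    (hout : Tendsto (chainOutput F b c lam z u 0) atTop (𝓝 0)) :
    Tendsto u atTop (𝓝 0) := by
  have hchain : ∀ j ≤ ρ, Tendsto (chainOutput F b c lam z u j) atTop (𝓝 0) := by
    intro j
    induction j with
    | zero => exact fun _ => hout
    | succ j ih =>
      intro hj
      have hYj := ih (by omega)
      refine (derivOnIci_chainOutput hz (h0 j (by omega))).tendsto_zero_of_tendsto_deriv_sub hYj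
        ?_ (hY (j + 1))
      have hrest :=
        (tendsto_const_dotProduct_zero (shiftedRow F c lam (j + 1)) hd).sub (hYj.const_mul lam)
      rw [mul_zero, sub_zero] at hrest
      exact hrest.congr fun t => by ring
  have hstate : Tendsto z atTop (𝓝 0) := by
    refine (hurwitzMatrix_inverse hF hmp hlam h0 hκ).tendsto_zero (derivOnIci_inverse hz hκ) ?_
    simpa using (((hchain ρ le_rfl).const_mul (shiftedRow F c lam ρ ⬝ᵥ b)⁻¹).smul_const b).add hd
  have hdrift := tendsto_const_dotProduct_zero (shiftedRow F c lam (ρ + 1)) hstate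
  have hu := ((hchain ρ le_rfl).sub hdrift).const_mul (shiftedRow F c lam ρ ⬝ᵥ b)⁻¹
  rw [sub_zero, mul_zero] at hu
  exact hu.congr fun t => (input_eq_of_chainOutput hκ t).symm

end FilterChain

section QuadraticForms

variable {ι κ : Type*} [Fintype ι] [Fintype κ] {z z' w w' : ℝ → ι → ℝ}

theorem DerivOnIci.dotProduct (hz : DerivOnIci z z') (hw : DerivOnIci w w') :
    DerivOnIci (fun t => z t ⬝ᵥ w t) (fun t => z' t ⬝ᵥ w t + z t ⬝ᵥ w' t) :=
  (DerivOnIci.sum fun i _ => (pi_iff.1 hz i).mul (pi_iff.1 hw i)).congr_deriv fun _ _ =>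
    Finset.sum_add_distrib

theorem DerivOnIci.mulVec (M : Matrix κ ι ℝ) (hz : DerivOnIci z z') :
    DerivOnIci (fun t => M *ᵥ z t) (fun t => M *ᵥ z' t) :=
  pi_iff.2 fun k => hz.const_dotProduct (M k)

theorem dotProduct_mulVec_comm_of_isSymm {P : Matrix ι ι ℝ} (hP : P.IsSymm) (v w : ι → ℝ) :
    v ⬝ᵥ (P *ᵥ w) = w ⬝ᵥ (P *ᵥ v) := by
  rw [Matrix.dotProduct_mulVec, ← Matrix.mulVec_transpose, hP.eq, dotProduct_comm]

theorem DerivOnIci.quadraticForm {P : Matrix ι ι ℝ} (hP : P.IsSymm) (hz : DerivOnIci z z') :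
    DerivOnIci (fun t => z t ⬝ᵥ (P *ᵥ z t)) (fun t => 2 * (z t ⬝ᵥ (P *ᵥ z' t))) :=
  (hz.dotProduct (hz.mulVec P)).congr_deriv fun t _ => by
    rw [dotProduct_mulVec_comm_of_isSymm hP (z' t), two_mul]

theorem dotProduct_self_nonneg (v : ι → ℝ) : 0 ≤ v ⬝ᵥ v :=
  Finset.sum_nonneg fun i _ => mul_self_nonneg (v i)

theorem dotProduct_sq_le (v w : ι → ℝ) : (v ⬝ᵥ w) ^ 2 ≤ (v ⬝ᵥ v) * (w ⬝ᵥ w) := by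
  simpa only [dotProduct, sq] using Finset.sum_mul_sq_le_sq_mul_sq Finset.univ v w

theorem dotProduct_self_eq_norm_sq (v : ι → ℝ) : v ⬝ᵥ v = ‖WithLp.toLp 2 v‖ ^ 2 := by
  rw [EuclideanSpace.real_norm_sq_eq]
  simp only [dotProduct, sq]

theorem pi_norm_sq_le_sum_norm_sq {E : Type*} [SeminormedAddCommGroup E] (v : ι → E) :
    ‖v‖ ^ 2 ≤ ∑ i, ‖v i‖ ^ 2 := by
  refine (Real.le_sqrt (norm_nonneg v) (by positivity)).1 ?_
  exact (pi_norm_le_iff_of_nonneg (Real.sqrt_nonneg _)).2 fun i => Real.le_sqrt_of_sq_le <|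
    Finset.single_le_sum (f := fun i => ‖v i‖ ^ 2) (fun i _ => sq_nonneg _) (Finset.mem_univ i)

theorem pi_norm_sq_le_dotProduct_self (v : ι → ℝ) : ‖v‖ ^ 2 ≤ v ⬝ᵥ v := by
  simpa only [dotProduct, sq, Real.norm_eq_abs, abs_mul_abs_self] using pi_norm_sq_le_sum_norm_sq v

theorem dotProduct_mulVec_eq_neg_of_lyapunov [DecidableEq ι] {Γ P : Matrix ι ι ℝ} (hP : P.IsSymm)
    (hLyap : Γᵀ * P + P * Γ = -(2 : ℝ) • (1 : Matrix ι ι ℝ)) (v : ι → ℝ) :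
    v ⬝ᵥ (P *ᵥ (Γ *ᵥ v)) = -(v ⬝ᵥ v) := by
  have hquad := congrArg (fun M => v ⬝ᵥ (M *ᵥ v)) hLyap
  simp only [Matrix.add_mulVec, Matrix.smul_mulVec, Matrix.one_mulVec, dotProduct_add,
    dotProduct_smul, smul_eq_mul, ← Matrix.mulVec_mulVec] at hquad
  have htranspose : v ⬝ᵥ (Γᵀ *ᵥ (P *ᵥ v)) = v ⬝ᵥ (P *ᵥ (Γ *ᵥ v)) := by
    rw [Matrix.dotProduct_mulVec, Matrix.vecMul_transpose, dotProduct_mulVec_comm_of_isSymm hP]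
  linarith

theorem isUnit_det_of_lyapunov [DecidableEq ι] {Γ P : Matrix ι ι ℝ} (hP : P.IsSymm)
    (hLyap : Γᵀ * P + P * Γ = -(2 : ℝ) • (1 : Matrix ι ι ℝ)) : IsUnit Γ.det := by
  rw [isUnit_iff_ne_zero]
  intro hdet
  obtain ⟨v, hv, hΓ⟩ := Matrix.exists_mulVec_eq_zero_iff.2 hdet
  have hvv := dotProduct_mulVec_eq_neg_of_lyapunov hP hLyap v
  rw [hΓ, Matrix.mulVec_zero, dotProduct_zero, zero_eq_neg] at hvv
  exact hv (dotProduct_self_eq_zero.1 hvv)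

open scoped MatrixOrder Matrix.Norms.L2Operator in
theorem exists_isUnit_transpose_mul_self_eq [DecidableEq ι] {P : Matrix ι ι ℝ} (hP : P.PosDef) :
    ∃ B : Matrix ι ι ℝ, IsUnit B ∧ P = Bᵀ * B :=
  CStarAlgebra.isStrictlyPositive_iff_eq_star_mul_self.1 hP.isStrictlyPositive

theorem BoundedSignal.of_posDef {P : Matrix ι ι ℝ} (hP : P.PosDef) {C : ℝ}
    (h : ∀ t, 0 ≤ t → z t ⬝ᵥ (P *ᵥ z t) ≤ C) : BoundedSignal z := by
  classical
  obtain ⟨B, hB, rfl⟩ := exists_isUnit_transpose_mul_self_eq hP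
  have hBz : BoundedSignal fun t => B *ᵥ z t := .of_sq_le fun t ht => by
    refine (pi_norm_sq_le_dotProduct_self _).trans ((le_of_eq ?_).trans (h t ht))
    rw [← Matrix.mulVec_mulVec, Matrix.dotProduct_mulVec _ Bᵀ, Matrix.vecMul_transpose]
  exact (hBz.mulVec B⁻¹).congr fun t _ => by
    rw [Matrix.mulVec_mulVec, Matrix.nonsing_inv_mul _ ((Matrix.isUnit_iff_isUnit_det B).1 hB),
      Matrix.one_mulVec]

end QuadraticForms

section ErrorModel

variable {ι κ : Type*} [Fintype ι] [Fintype κ] {Γ P : Matrix κ κ ℝ} {l p : κ → ℝ} {lam μ : ℝ}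

theorem Dissipated.of_derivOnIci {E : Type*} [Norm E] {f : ℝ → E} {V V' : ℝ → ℝ}
    (hV : DerivOnIci V V') (hV0 : ∀ t, 0 ≤ t → 0 ≤ V t) {a : ℝ} (ha : 0 < a)
    (h : ∀ t, 0 ≤ t → V' t ≤ -(a * ‖f t‖ ^ 2)) : Dissipated f := by
  refine ⟨_, _, hV.const_mul a⁻¹, fun t ht => ⟨by have := hV0 t ht; positivity, ?_⟩⟩
  calc a⁻¹ * V' t ≤ a⁻¹ * -(a * ‖f t‖ ^ 2) := by gcongr; exact h t ht
    _ = -‖f t‖ ^ 2 := by field_simp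

/-- The closed loop in error coordinates: `e` is the output error, `ε` a transient, `ϖ` the
regressor, and the estimate of `θ i` is `ψ i + l ⬝ᵥ ξ i`, where `ξ i` is the deviation of the
`i`-th tuner filter from the equilibrium belonging to the current value of `ψ i`. -/
structure IsErrorModel (Γ : Matrix κ κ ℝ) (l p : κ → ℝ) (lam μ : ℝ) (θ : ι → ℝ) (e ε : ℝ → ℝ)
    (ϖ ψ : ℝ → ι → ℝ) (ξ : ℝ → ι → κ → ℝ) : Prop where
  error : DerivOnIci e fun t => -lam * e t + ϖ t ⬝ᵥ (θ - (ψ t + fun i => l ⬝ᵥ ξ t i)) + ε t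
  integrator : DerivOnIci ψ fun t => e t • ϖ t
  filter : DerivOnIci ξ fun t i => (1 + μ * (ϖ t ⬝ᵥ ϖ t)) • (Γ *ᵥ ξ t i) + (e t * ϖ t i) • p

/-- The Lyapunov function of the error model, without the contribution of the transient. -/
noncomputable def errorEnergy (P : Matrix κ κ ℝ) (θ : ι → ℝ) (e : ℝ) (ψ : ι → ℝ)
    (ξ : ι → κ → ℝ) : ℝ :=
  1 / 2 * (e ^ 2 + (θ - ψ) ⬝ᵥ (θ - ψ) + ∑ i, ξ i ⬝ᵥ (P *ᵥ ξ i))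

theorem sq_dotProduct_dotProduct_le (ϖ : ι → ℝ) (w : κ → ℝ) (ξ : ι → κ → ℝ) :
    (ϖ ⬝ᵥ fun i => w ⬝ᵥ ξ i) ^ 2 ≤ (w ⬝ᵥ w) * ((ϖ ⬝ᵥ ϖ) * ∑ i, ξ i ⬝ᵥ ξ i) :=
  calc (ϖ ⬝ᵥ fun i => w ⬝ᵥ ξ i) ^ 2
      ≤ (ϖ ⬝ᵥ ϖ) * ∑ i, (w ⬝ᵥ ξ i) ^ 2 := by
        simpa only [dotProduct, sq] using dotProduct_sq_le ϖ fun i => w ⬝ᵥ ξ i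
    _ ≤ (ϖ ⬝ᵥ ϖ) * ∑ i, (w ⬝ᵥ w) * (ξ i ⬝ᵥ ξ i) := by
        gcongr with i
        · exact dotProduct_self_nonneg ϖ
        · exact dotProduct_sq_le _ _
    _ = (w ⬝ᵥ w) * ((ϖ ⬝ᵥ ϖ) * ∑ i, ξ i ⬝ᵥ ξ i) := by rw [← Finset.mul_sum]; ring

theorem mul_dotProduct_dotProduct_le {w : κ → ℝ} (hlam : 0 < lam)
    (hμ : 3 / (4 * lam) * (w ⬝ᵥ w) ≤ μ) (e : ℝ) (ϖ : ι → ℝ) (ξ : ι → κ → ℝ) :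
    e * (ϖ ⬝ᵥ fun i => w ⬝ᵥ ξ i) ≤
      lam / 3 * e ^ 2 + μ * ((ϖ ⬝ᵥ ϖ) * ∑ i, ξ i ⬝ᵥ ξ i) := by
  have hnonneg : 0 ≤ (ϖ ⬝ᵥ ϖ) * ∑ i, ξ i ⬝ᵥ ξ i :=
    mul_nonneg (dotProduct_self_nonneg ϖ) (Finset.sum_nonneg fun i _ => dotProduct_self_nonneg _)
  calc e * (ϖ ⬝ᵥ fun i => w ⬝ᵥ ξ i)
      ≤ lam / 3 * e ^ 2 + 3 / (4 * lam) * (ϖ ⬝ᵥ fun i => w ⬝ᵥ ξ i) ^ 2 := by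
        have hsq : 0 ≤ 3 / (4 * lam) * (2 * lam / 3 * e - ϖ ⬝ᵥ fun i => w ⬝ᵥ ξ i) ^ 2 := by
          positivity
        refine sub_nonneg.1 (hsq.trans_eq ?_)
        field_simp
        ring
    _ ≤ lam / 3 * e ^ 2 + 3 / (4 * lam) * ((w ⬝ᵥ w) * ((ϖ ⬝ᵥ ϖ) * ∑ i, ξ i ⬝ᵥ ξ i)) := by
        gcongr
        exact sq_dotProduct_dotProduct_le ϖ w ξ
    _ ≤ lam / 3 * e ^ 2 + μ * ((ϖ ⬝ᵥ ϖ) * ∑ i, ξ i ⬝ᵥ ξ i) := by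
        rw [← mul_assoc]
        gcongr

theorem mul_gain_le (hlam : 0 < lam) (v w : κ → ℝ)
    (hμ : μ > 3 / (4 * lam) * (‖WithLp.toLp 2 v‖ + ‖WithLp.toLp 2 w‖) ^ 2) :
    3 / (4 * lam) * ((w - v) ⬝ᵥ (w - v)) ≤ μ := by
  refine le_trans ?_ hμ.le
  rw [dotProduct_self_eq_norm_sq, WithLp.toLp_sub, add_comm ‖WithLp.toLp 2 v‖]
  gcongr
  exact norm_sub_le _ _

theorem sum_dotProduct_mulVec_of_lyapunov [DecidableEq κ] (hP : P.IsSymm)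
    (hLyap : Γᵀ * P + P * Γ = -(2 : ℝ) • (1 : Matrix κ κ ℝ)) (g e : ℝ) (ϖ : ι → ℝ)
    (ξ : ι → κ → ℝ) :
    ∑ i, ξ i ⬝ᵥ (P *ᵥ (g • (Γ *ᵥ ξ i) + (e * ϖ i) • p)) =
      -(g * ∑ i, ξ i ⬝ᵥ ξ i) + e * (ϖ ⬝ᵥ fun i => (P *ᵥ p) ⬝ᵥ ξ i) := by
  rw [dotProduct, Finset.mul_sum, Finset.mul_sum, ← Finset.sum_neg_distrib,
    ← Finset.sum_add_distrib]
  refine Finset.sum_congr rfl fun i _ => ?_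
  simp only [Matrix.mulVec_add, Matrix.mulVec_smul, dotProduct_add, dotProduct_smul,
    dotProduct_mulVec_eq_neg_of_lyapunov hP hLyap, dotProduct_comm (P *ᵥ p), smul_eq_mul]
  ring

theorem errorEnergy_rate_le (hlam : 0 < lam) {w : κ → ℝ} (hμ : 3 / (4 * lam) * (w ⬝ᵥ w) ≤ μ)
    {e ε U' : ℝ} (hU : U' ≤ -‖ε‖ ^ 2) (ϖ : ι → ℝ) (ξ : ι → κ → ℝ) :
    -lam * e ^ 2 + e * ε + e * (ϖ ⬝ᵥ fun i => w ⬝ᵥ ξ i) -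
        (1 + μ * (ϖ ⬝ᵥ ϖ)) * ∑ i, ξ i ⬝ᵥ ξ i + 3 / (4 * lam) * U' ≤
      -(lam / 3 * e ^ 2 + ∑ i, ξ i ⬝ᵥ ξ i) := by
  have hcross := mul_dotProduct_dotProduct_le hlam hμ e ϖ ξ
  have htransient : e * ε + 3 / (4 * lam) * U' ≤ lam / 3 * e ^ 2 :=
    calc e * ε + 3 / (4 * lam) * U' ≤ e * ε + 3 / (4 * lam) * -ε ^ 2 := by
          gcongr
          simpa using hU
      _ ≤ lam / 3 * e ^ 2 := by
          have hsq : 0 ≤ 3 / (4 * lam) * (2 * lam / 3 * e - ε) ^ 2 := by positivity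
          refine sub_nonneg.1 (hsq.trans_eq ?_)
          field_simp
          ring
  linarith

theorem errorEnergy_nonneg (hP : P.PosSemidef) (θ : ι → ℝ) (e : ℝ) (ψ : ι → ℝ) (ξ : ι → κ → ℝ) :
    0 ≤ errorEnergy P θ e ψ ξ :=
  mul_nonneg one_half_pos.le (add_nonneg (add_nonneg (sq_nonneg e) (dotProduct_self_nonneg _))
    (Finset.sum_nonneg fun i _ => hP.dotProduct_mulVec_nonneg (ξ i)))

theorem boundedSignal_of_errorEnergy_le (hP : P.PosDef) {θ : ι → ℝ} {e : ℝ → ℝ} {ψ : ℝ → ι → ℝ}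
    {ξ : ℝ → ι → κ → ℝ} {C : ℝ}
    (hC : ∀ t, 0 ≤ t → errorEnergy P θ (e t) (ψ t) (ξ t) ≤ C) :
    BoundedSignal e ∧ BoundedSignal ψ ∧ BoundedSignal ξ := by
  have hform : ∀ t i, 0 ≤ ξ t i ⬝ᵥ (P *ᵥ ξ t i) := fun t i =>
    hP.posSemidef.dotProduct_mulVec_nonneg (ξ t i)
  have hsum : ∀ t, 0 ≤ ∑ i, ξ t i ⬝ᵥ (P *ᵥ ξ t i) := fun t =>
    Finset.sum_nonneg fun i _ => hform t i
  have hparam := fun t => dotProduct_self_nonneg (θ - ψ t)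
  simp only [errorEnergy] at hC
  refine ⟨.of_sq_le (C := 2 * C) fun t ht => ?_, ?_,
    BoundedSignal.pi_iff.2 fun i => .of_posDef hP (C := 2 * C) fun t ht => ?_⟩
  · rw [Real.norm_eq_abs, sq_abs]
    linarith [hC t ht, hsum t, hparam t]
  · have herror : BoundedSignal fun t => θ - ψ t := .of_sq_le (C := 2 * C) fun t ht =>
      (pi_norm_sq_le_dotProduct_self _).trans <| by
        linarith [hC t ht, hsum t, sq_nonneg (e t)]
    exact ((BoundedSignal.const θ).sub herror).congr fun t _ => (sub_sub_cancel θ _).symm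
  · have hle := Finset.single_le_sum (f := fun i => ξ t i ⬝ᵥ (P *ᵥ ξ t i))
      (fun i _ => hform t i) (Finset.mem_univ i)
    linarith [hC t ht, hparam t, sq_nonneg (e t)]

namespace IsErrorModel

variable {θ : ι → ℝ} {e ε : ℝ → ℝ} {ϖ ψ : ℝ → ι → ℝ} {ξ : ℝ → ι → κ → ℝ}

theorem derivOnIci_errorEnergy [DecidableEq κ] (h : IsErrorModel Γ l p lam μ θ e ε ϖ ψ ξ)
    (hP : P.IsSymm) (hLyap : Γᵀ * P + P * Γ = -(2 : ℝ) • (1 : Matrix κ κ ℝ)) :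
    DerivOnIci (fun t => errorEnergy P θ (e t) (ψ t) (ξ t)) fun t =>
      -lam * e t ^ 2 + e t * ε t + e t * (ϖ t ⬝ᵥ fun i => (P *ᵥ p - l) ⬝ᵥ ξ t i) -
        (1 + μ * (ϖ t ⬝ᵥ ϖ t)) * ∑ i, ξ t i ⬝ᵥ ξ t i := by
  have herror : DerivOnIci (fun t => e t ^ 2) _ :=
    (h.error.mul h.error).congr fun t _ => sq (e t)
  have hparam : DerivOnIci (fun t => (θ - ψ t) ⬝ᵥ (θ - ψ t)) _ :=
    ((DerivOnIci.const θ).sub h.integrator).dotProduct ((DerivOnIci.const θ).sub h.integrator)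
  have hfilter : DerivOnIci (fun t => ∑ i, ξ t i ⬝ᵥ (P *ᵥ ξ t i)) _ :=
    .sum fun i _ => (DerivOnIci.pi_iff.1 h.filter i).quadraticForm hP
  refine (((herror.add hparam).add hfilter).const_mul (1 / 2)).congr_deriv fun t _ => ?_
  have hcross : (ϖ t ⬝ᵥ fun i => (P *ᵥ p - l) ⬝ᵥ ξ t i) =
      (ϖ t ⬝ᵥ fun i => (P *ᵥ p) ⬝ᵥ ξ t i) - ϖ t ⬝ᵥ fun i => l ⬝ᵥ ξ t i := by
    simp only [sub_dotProduct]
    exact dotProduct_sub _ _ _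
  rw [← Finset.mul_sum, sum_dotProduct_mulVec_of_lyapunov hP hLyap, hcross]
  simp only [← sub_sub, dotProduct_sub, zero_sub, neg_dotProduct,
    dotProduct_neg, smul_dotProduct, dotProduct_smul, smul_eq_mul, dotProduct_comm _ (ϖ t)]
  ring

theorem exists_lyapunov [DecidableEq κ] (h : IsErrorModel Γ l p lam μ θ e ε ϖ ψ ξ)
    (hP : P.IsSymm) (hLyap : Γᵀ * P + P * Γ = -(2 : ℝ) • (1 : Matrix κ κ ℝ)) (hlam : 0 < lam)
    (hμ : μ > 3 / (4 * lam) * (‖WithLp.toLp 2 l‖ + ‖WithLp.toLp 2 (P *ᵥ p)‖) ^ 2)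
    (hε : Dissipated ε) :
    ∃ V V' : ℝ → ℝ, DerivOnIci V V' ∧ ∀ t, 0 ≤ t → errorEnergy P θ (e t) (ψ t) (ξ t) ≤ V t ∧
      V' t ≤ -(lam / 3 * e t ^ 2 + ∑ i, ξ t i ⬝ᵥ ξ t i) := by
  obtain ⟨U, U', hU, hU'⟩ := hε
  refine ⟨_, _, (h.derivOnIci_errorEnergy hP hLyap).add (hU.const_mul (3 / (4 * lam))),
    fun t ht => ⟨le_add_of_nonneg_right (mul_nonneg (by positivity) (hU' t ht).1),
      errorEnergy_rate_le hlam (mul_gain_le hlam l (P *ᵥ p) hμ) (hU' t ht).2 (ϖ t) (ξ t)⟩⟩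

theorem smoothBounded_succ (h : IsErrorModel Γ l p lam μ θ e ε ϖ ψ ξ) {ρ : ℕ}
    (he : SmoothBounded ρ e) (hψ : SmoothBounded ρ ψ) (hξ : SmoothBounded ρ ξ)
    (hε : SmoothBounded ρ ε) (hϖ : SmoothBounded ρ ϖ) :
    SmoothBounded (ρ + 1) e ∧ SmoothBounded (ρ + 1) ψ ∧ SmoothBounded (ρ + 1) ξ := by
  have hestimate : SmoothBounded ρ fun t i => ψ t i + l ⬝ᵥ ξ t i :=
    hψ.add (SmoothBounded.pi_iff.2 fun i =>
      (SmoothBounded.const ρ l).dotProduct (SmoothBounded.pi_iff.1 hξ i))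
  refine ⟨⟨he.boundedSignal, _, h.error, ?_⟩, ⟨hψ.boundedSignal, _, h.integrator, he.smul hϖ⟩,
    hξ.boundedSignal, _, h.filter, SmoothBounded.pi_iff.2 fun i => ?_⟩
  · exact (((SmoothBounded.const ρ (-lam)).smul he).add
      (hϖ.dotProduct ((SmoothBounded.const ρ θ).sub hestimate))).add hε
  · have hgain : SmoothBounded ρ fun t => 1 + μ * (ϖ t ⬝ᵥ ϖ t) :=
      (SmoothBounded.const ρ 1).add ((SmoothBounded.const ρ μ).smul (hϖ.dotProduct hϖ))
    exact (hgain.smul ((SmoothBounded.pi_iff.1 hξ i).mulVec Γ)).add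
      ((he.smul (SmoothBounded.pi_iff.1 hϖ i)).smul (SmoothBounded.const ρ p))

theorem smoothBounded (h : IsErrorModel Γ l p lam μ θ e ε ϖ ψ ξ) {ρ : ℕ} (he : BoundedSignal e)
    (hψ : BoundedSignal ψ) (hξ : BoundedSignal ξ)
    (hε : SmoothBounded ρ ε) (hϖ : SmoothBounded ρ ϖ) :
    SmoothBounded (ρ + 1) e ∧ SmoothBounded (ρ + 1) ψ ∧ SmoothBounded (ρ + 1) ξ := by
  induction ρ with
  | zero => exact h.smoothBounded_succ he hψ hξ hε hϖ
  | succ ρ ih =>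
    obtain ⟨he', hψ', hξ'⟩ := ih hε.of_succ hϖ.of_succ
    exact h.smoothBounded_succ he' hψ' hξ' hε hϖ

theorem tendsto_regressor_error (h : IsErrorModel Γ l p lam μ θ e ε ϖ ψ ξ)
    (he : Tendsto e atTop (𝓝 0)) (hξ : Tendsto ξ atTop (𝓝 0)) (hε : Tendsto ε atTop (𝓝 0))
    (hϖ : BoundedSignal ϖ)
    (hc : UniformContinuousOn (fun t => ϖ t ⬝ᵥ (θ - ψ t)) (Set.Ici 0)) :
    Tendsto (fun t => ϖ t ⬝ᵥ (θ - ψ t)) atTop (𝓝 0) := by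
  refine h.error.tendsto_zero_of_tendsto_deriv_sub he ?_ hc
  have hread : Tendsto (fun t => ϖ t ⬝ᵥ fun i => l ⬝ᵥ ξ t i) atTop (𝓝 0) := by
    have hl : ∀ i, Tendsto (fun t => l ⬝ᵥ ξ t i) atTop (𝓝 0) := fun i =>
      tendsto_const_dotProduct_zero l (tendsto_pi_nhds.1 hξ i)
    simpa [dotProduct, mul_comm] using tendsto_finsetSum Finset.univ fun i _ =>
      (BoundedSignal.pi_iff.1 hϖ i).tendsto_smul_zero (hl i)
  have hrest := ((he.const_mul (-lam)).sub hread).add hε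
  rw [mul_zero, sub_zero, add_zero] at hrest
  refine hrest.congr fun t => ?_
  rw [← sub_sub, dotProduct_sub]
  ring

variable [DecidableEq κ] (h : IsErrorModel Γ l p lam μ θ e ε ϖ ψ ξ)
  (hP : P.PosDef) (hLyap : Γᵀ * P + P * Γ = -(2 : ℝ) • (1 : Matrix κ κ ℝ)) (hlam : 0 < lam)
  (hμ : μ > 3 / (4 * lam) * (‖WithLp.toLp 2 l‖ + ‖WithLp.toLp 2 (P *ᵥ p)‖) ^ 2)
  (hε : Dissipated ε)

include h hP hLyap hlam hμ hε

theorem boundedSignal : BoundedSignal e ∧ BoundedSignal ψ ∧ BoundedSignal ξ := by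
  obtain ⟨V, V', hV, hle⟩ := h.exists_lyapunov (by simpa using hP.isHermitian) hLyap hlam hμ hε
  have hanti := hV.antitoneOn fun t ht => (hle t ht).2.trans <| neg_nonpos.2 <|
    add_nonneg (by positivity) (Finset.sum_nonneg fun i _ => dotProduct_self_nonneg (ξ t i))
  exact boundedSignal_of_errorEnergy_le hP fun t ht =>
    (hle t ht).1.trans (hanti Set.self_mem_Ici ht ht)

theorem dissipated : Dissipated e ∧ Dissipated ξ := by
  obtain ⟨V, V', hV, hle⟩ := h.exists_lyapunov (by simpa using hP.isHermitian) hLyap hlam hμ hε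
  have hV0 : ∀ t, 0 ≤ t → 0 ≤ V t := fun t ht =>
    (errorEnergy_nonneg hP.posSemidef θ (e t) (ψ t) (ξ t)).trans (hle t ht).1
  have hξ : ∀ t, ‖ξ t‖ ^ 2 ≤ ∑ i, ξ t i ⬝ᵥ ξ t i := fun t =>
    (pi_norm_sq_le_sum_norm_sq (ξ t)).trans <|
      Finset.sum_le_sum fun i _ => pi_norm_sq_le_dotProduct_self (ξ t i)
  refine ⟨.of_derivOnIci hV hV0 (a := lam / 3) (by positivity) fun t ht => ?_,
    .of_derivOnIci hV hV0 one_pos fun t ht => ?_⟩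
  · rw [Real.norm_eq_abs, sq_abs]
    linarith [(hle t ht).2, (sq_nonneg ‖ξ t‖).trans (hξ t)]
  · have he : 0 ≤ lam / 3 * e t ^ 2 := by positivity
    linarith [(hle t ht).2, hξ t]

theorem tendsto_zero (hεb : BoundedSignal ε) (hϖ : BoundedSignal ϖ) :
    Tendsto e atTop (𝓝 0) ∧ Tendsto ξ atTop (𝓝 0) := by
  obtain ⟨he, hψ, hξ⟩ := h.boundedSignal hP hLyap hlam hμ hε
  obtain ⟨he₂, hξ₂⟩ := h.dissipated hP hLyap hlam hμ hε
  obtain ⟨he', -, hξ'⟩ := h.smoothBounded (ρ := 0) he hψ hξ hεb hϖ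
  exact ⟨he₂.tendsto_zero he he'.uniformContinuousOn, hξ₂.tendsto_zero hξ hξ'.uniformContinuousOn⟩

end IsErrorModel

end ErrorModel

section Excitation

variable {m : ℕ} {f ϑ ϑ' : ℝ → Fin m → ℝ} {T : ℝ}

theorem abs_dotProduct_le {ι : Type*} [Fintype ι] (v w : ι → ℝ) :
    |v ⬝ᵥ w| ≤ Fintype.card ι * ‖v‖ * ‖w‖ :=
  calc |v ⬝ᵥ w| ≤ ∑ i, |v i * w i| := Finset.abs_sum_le_sum_abs _ _
    _ ≤ ∑ _i : ι, ‖v‖ * ‖w‖ := Finset.sum_le_sum fun i _ => by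
      rw [abs_mul]
      gcongr
      exacts [norm_le_pi_norm v i, norm_le_pi_norm w i]
    _ = Fintype.card ι * ‖v‖ * ‖w‖ := by simp [mul_assoc]

theorem DerivOnIci.eventually_norm_sub_le {E : Type*} [NormedAddCommGroup E] [NormedSpace ℝ E]
    {f f' : ℝ → E} (hf : DerivOnIci f f') (hf' : Tendsto f' atTop (𝓝 0)) (hT : 0 < T) {ε : ℝ}
    (hε : 0 < ε) : ∀ᶠ t in atTop, ∀ s ∈ Set.Icc t (t + T), ‖f s - f t‖ ≤ ε := by
  have hsmall : ∀ᶠ x in atTop, ‖f' x‖ < ε / T :=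
    NormedAddGroup.tendsto_nhds_zero.1 hf' _ (by positivity)
  filter_upwards [eventually_forall_ge_atTop.2 hsmall, eventually_ge_atTop 0] with t ht ht0 s hs
  calc ‖f s - f t‖ ≤ ε / T * ‖s - t‖ :=
        Convex.norm_image_sub_le_of_norm_hasDerivWithin_le (s := Set.Ici t)
          (fun x hx => (hf x (ht0.trans hx)).mono (Set.Ici_subset_Ici.2 ht0))
          (fun x hx => (ht x hx).le) (convex_Ici t) Set.self_mem_Ici hs.1
    _ ≤ ε / T * T := by
        gcongr
        rw [Real.norm_eq_abs, abs_of_nonneg (sub_nonneg.2 hs.1)]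
        linarith [hs.2]
    _ = ε := div_mul_cancel₀ ε hT.ne'

theorem BoundedSignal.eventually_abs_dotProduct_le (hf : BoundedSignal f)
    (hϑ : DerivOnIci ϑ ϑ') (hϑ' : Tendsto ϑ' atTop (𝓝 0))
    (hfϑ : Tendsto (fun t => f t ⬝ᵥ ϑ t) atTop (𝓝 0)) (hT : 0 < T) {ε : ℝ} (hε : 0 < ε) :
    ∀ᶠ t in atTop, ∀ s ∈ Set.Icc t (t + T), |f s ⬝ᵥ ϑ t| ≤ ε := by
  obtain ⟨C, hC⟩ := hf
  have hC0 : 0 ≤ C := (norm_nonneg _).trans (hC 0 le_rfl)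
  have hslow := hϑ.eventually_norm_sub_le hϑ' hT
    (ε := ε / 2 / (m * C + 1)) (by positivity)
  have hsmall : ∀ᶠ x in atTop, ‖f x ⬝ᵥ ϑ x‖ < ε / 2 :=
    NormedAddGroup.tendsto_nhds_zero.1 hfϑ _ (by positivity)
  filter_upwards [hslow, eventually_forall_ge_atTop.2 hsmall, eventually_ge_atTop 0]
    with t ht ht' ht0 s hs
  have hincrement : |f s ⬝ᵥ (ϑ s - ϑ t)| ≤ ε / 2 :=
    calc |f s ⬝ᵥ (ϑ s - ϑ t)| ≤ m * ‖f s‖ * ‖ϑ s - ϑ t‖ := by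
          simpa using abs_dotProduct_le (f s) (ϑ s - ϑ t)
      _ ≤ (m * C + 1) * (ε / 2 / (m * C + 1)) := by
          gcongr
          · exact (mul_le_mul_of_nonneg_left (hC s (ht0.trans hs.1)) m.cast_nonneg).trans
              (le_add_of_nonneg_right zero_le_one)
          · exact ht s hs
      _ = ε / 2 := mul_div_cancel₀ _ (by positivity)
  calc |f s ⬝ᵥ ϑ t| = |f s ⬝ᵥ ϑ s - f s ⬝ᵥ (ϑ s - ϑ t)| := by rw [dotProduct_sub, sub_sub_cancel]
    _ ≤ |f s ⬝ᵥ ϑ s| + |f s ⬝ᵥ (ϑ s - ϑ t)| := abs_sub _ _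
    _ ≤ ε / 2 + ε / 2 := add_le_add (ht' s hs.1).le hincrement
    _ = ε := add_halves ε

theorem dotProduct_integral_mulVec {a b : ℝ}
    (hf : ∀ i j, IntervalIntegrable (fun s => f s i * f s j) MeasureTheory.volume a b)
    (v : Fin m → ℝ) :
    v ⬝ᵥ (Matrix.of (fun i j => ∫ s in a..b, f s i * f s j) *ᵥ v) =
      ∫ s in a..b, (f s ⬝ᵥ v) ^ 2 := by
  have hexpand : (fun s => (f s ⬝ᵥ v) ^ 2) =
      fun s => ∑ i, ∑ j, v i * v j * (f s i * f s j) := by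
    ext s
    rw [sq, dotProduct, Finset.sum_mul_sum]
    exact Finset.sum_congr rfl fun i _ => Finset.sum_congr rfl fun j _ => by ring
  have hrow : ∀ i, IntervalIntegrable (fun s => ∑ j, v i * v j * (f s i * f s j))
      MeasureTheory.volume a b := fun i => by
    simpa only [Finset.sum_fn] using IntervalIntegrable.sum Finset.univ
      fun j _ => (hf i j).const_mul (v i * v j)
  rw [hexpand, intervalIntegral.integral_finsetSum fun i _ => hrow i]
  refine (Finset.sum_congr rfl fun i _ => ?_)
  rw [intervalIntegral.integral_finsetSum fun j _ => (hf i j).const_mul _, Matrix.mulVec,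
    dotProduct, Finset.mul_sum]
  refine Finset.sum_congr rfl fun j _ => ?_
  rw [intervalIntegral.integral_const_mul, Matrix.of_apply]
  ring

namespace PersistentlyExciting

theorem intervalIntegrable_mul (hf : PersistentlyExciting f) (i j : Fin m) {a b : ℝ}
    (ha : 0 ≤ a) (hb : 0 ≤ b) :
    IntervalIntegrable (fun s => f s i * f s j) MeasureTheory.volume a b := by
  obtain ⟨hmeas, hbound, -⟩ := hf
  obtain ⟨C, hC⟩ := (BoundedSignal.pi_iff.1 hbound i).mul (BoundedSignal.pi_iff.1 hbound j)
  have hsub : Set.uIoc a b ⊆ Set.Ici 0 := fun s hs => (le_min ha hb).trans hs.1.le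
  have hcoord : ∀ l, Measurable fun s : Set.Ici (0 : ℝ) => f s l :=
    fun l => (measurable_pi_apply l).comp hmeas
  have haem : AEMeasurable (fun s => f s i * f s j)
      (MeasureTheory.volume.restrict (Set.Ici 0)) :=
    (aemeasurable_restrict_iff_comap_subtype measurableSet_Ici).2
      ((hcoord i).mul (hcoord j)).aemeasurable
  have haem' := haem.mono_measure (MeasureTheory.Measure.restrict_mono hsub le_rfl)
  refine intervalIntegrable_iff.2 (MeasureTheory.IntegrableOn.of_bound ?_
    haem'.aestronglyMeasurable C ?_)
  · simp [Set.uIoc]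
  · exact (MeasureTheory.ae_restrict_mem measurableSet_uIoc).mono fun s hs => hC s (hsub hs)

theorem exists_le_integral (hf : PersistentlyExciting f) :
    ∃ α > (0 : ℝ), ∃ T > (0 : ℝ), ∀ t : ℝ, 0 ≤ t → ∀ v : Fin m → ℝ,
      α * (v ⬝ᵥ v) ≤ ∫ s in t..(t + T), (f s ⬝ᵥ v) ^ 2 := by
  obtain ⟨α, hα, T, hT, hpos⟩ := hf.2.2
  refine ⟨α, hα, T, hT, fun t ht v => ?_⟩
  have hnonneg := (hpos t ht).dotProduct_mulVec_nonneg v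
  rw [Matrix.sub_mulVec, dotProduct_sub, Matrix.smul_mulVec, Matrix.one_mulVec,
    dotProduct_smul, smul_eq_mul, star_trivial, sub_nonneg] at hnonneg
  refine hnonneg.trans_eq (dotProduct_integral_mulVec (fun i j => ?_) v)
  exact hf.intervalIntegrable_mul i j ht (by positivity)

theorem tendsto_zero (hf : PersistentlyExciting f) (hϑ : DerivOnIci ϑ ϑ')
    (hϑ' : Tendsto ϑ' atTop (𝓝 0)) (hfϑ : Tendsto (fun t => f t ⬝ᵥ ϑ t) atTop (𝓝 0)) :
    Tendsto ϑ atTop (𝓝 0) := by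
  obtain ⟨α, hα, T, hT, hexc⟩ := hf.exists_le_integral
  refine NormedAddGroup.tendsto_nhds_zero.2 fun ε hε => ?_
  have hwindow := hf.2.1.eventually_abs_dotProduct_le hϑ hϑ' hfϑ hT
    (ε := √(α / T) * (ε / 2)) (by positivity)
  filter_upwards [hwindow, eventually_ge_atTop 0] with t ht ht0
  have hsq : α * ‖ϑ t‖ ^ 2 ≤ α * (ε / 2) ^ 2 :=
    calc α * ‖ϑ t‖ ^ 2 ≤ α * (ϑ t ⬝ᵥ ϑ t) := by
          gcongr
          exact pi_norm_sq_le_dotProduct_self _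
      _ ≤ ∫ s in t..(t + T), (f s ⬝ᵥ ϑ t) ^ 2 := hexc t ht0 _
      _ ≤ ‖∫ s in t..(t + T), (f s ⬝ᵥ ϑ t) ^ 2‖ := le_abs_self _
      _ ≤ (√(α / T) * (ε / 2)) ^ 2 * |t + T - t| :=
          intervalIntegral.norm_integral_le_of_norm_le_const fun s hs => by
            rw [Set.uIoc_of_le (by linarith)] at hs
            rw [Real.norm_eq_abs, abs_pow]
            gcongr
            exact ht s ⟨hs.1.le, hs.2⟩
      _ = α * (ε / 2) ^ 2 := by
          rw [add_sub_cancel_left, abs_of_pos hT, mul_pow, Real.sq_sqrt (by positivity)]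
          field_simp
  exact (abs_le_of_sq_le_sq' (le_of_mul_le_mul_left hsq hα) (by positivity)).2.trans_lt
    (half_lt_self hε)

end PersistentlyExciting

end Excitation

section Combination

variable {n m ρ : ℕ} {F : Matrix (Fin n) (Fin n) ℝ} {b c : Fin n → ℝ} {lam : ℝ}
  {ϑ ϑ' f : ℝ → Fin m → ℝ} {z : ℝ → Fin m → Fin n → ℝ}

theorem derivOnIci_combination
    (hz : ∀ i, DerivOnIci (fun t => z t i) fun t => F *ᵥ z t i + f t i • b)
    (hϑ : DerivOnIci ϑ ϑ') :
    DerivOnIci (fun t => ∑ i, ϑ t i • z t i) fun t =>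
      F *ᵥ (∑ i, ϑ t i • z t i) + (f t ⬝ᵥ ϑ t) • b + ∑ i, ϑ' t i • z t i := by
  have hsum := DerivOnIci.sum (s := Finset.univ) fun i _ => (DerivOnIci.pi_iff.1 hϑ i).smul (hz i)
  refine hsum.congr_deriv fun t _ => ?_
  rw [Matrix.mulVec_sum, dotProduct, Finset.sum_smul, ← Finset.sum_add_distrib,
    ← Finset.sum_add_distrib]
  refine Finset.sum_congr rfl fun i _ => ?_
  rw [Matrix.mulVec_smul, smul_add, smul_smul, mul_comm]

theorem chainOutput_combination (j : ℕ) (t : ℝ) :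
    chainOutput F b c lam (fun t => ∑ i, ϑ t i • z t i) (fun t => f t ⬝ᵥ ϑ t) j t =
      ∑ i, ϑ t i * chainOutput F b c lam (fun t => z t i) (fun t => f t i) j t := by
  simp only [chainOutput]
  rw [dotProduct_sum, dotProduct_comm (f t), dotProduct.eq_def (ϑ t), Finset.mul_sum,
    ← Finset.sum_add_distrib]
  refine Finset.sum_congr rfl fun i _ => ?_
  rw [dotProduct_smul, smul_eq_mul]
  ring

theorem uniformContinuousOn_chainOutput_combination
    (hz : ∀ i, DerivOnIci (fun t => z t i) fun t => F *ᵥ z t i + f t i • b)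
    (hzb : BoundedSignal z) (hfb : BoundedSignal f) (hfc : UniformContinuousOn f (Set.Ici 0))
    (hϑ : DerivOnIci ϑ ϑ') (hϑb : BoundedSignal ϑ) (hϑb' : BoundedSignal ϑ') (j : ℕ) :
    UniformContinuousOn
      (chainOutput F b c lam (fun t => ∑ i, ϑ t i • z t i) (fun t => f t ⬝ᵥ ϑ t) j)
      (Set.Ici 0) := by
  have hcomb : ∀ {a : ℝ → Fin m → ℝ}, BoundedSignal a →
      BoundedSignal fun t => ∑ i, a t i • z t i := fun ha =>
    .sum fun i _ => (BoundedSignal.pi_iff.1 ha i).smul (BoundedSignal.pi_iff.1 hzb i)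
  have hu := hfb.dotProduct hϑb
  have huc : UniformContinuousOn (fun t => f t ⬝ᵥ ϑ t) (Set.Ici 0) :=
    hfb.uniformContinuousOn_comp₂ (Φ := fun p => p.1 ⬝ᵥ p.2) (by fun_prop) hfc hϑb
      (hϑ.uniformContinuousOn hϑb')
  have hZc := (derivOnIci_combination hz hϑ).uniformContinuousOn
    ((((hcomb hϑb).mulVec F).add (hu.smul (.const b))).add (hcomb hϑb'))
  exact (hcomb hϑb).uniformContinuousOn_comp₂ (Φ := fun p =>
    shiftedRow F c lam (j + 1) ⬝ᵥ p.1 + (shiftedRow F c lam j ⬝ᵥ b) * p.2)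
    (by fun_prop) hZc hu huc

-- With slowly varying coefficients `ϑ`, the combination of the filters is, up to a vanishing
-- perturbation of the state equation, a copy of the filter driven by the combined input.
theorem tendsto_input_combination_zero (hF : HurwitzMatrix F)
    (hmp : MinimumPhase (transferFn F b c 0)) (hlam : 0 < lam)
    (hz : ∀ i, DerivOnIci (fun t => z t i) fun t => F *ᵥ z t i + f t i • b)
    (hzb : BoundedSignal z) (hfb : BoundedSignal f) (hfc : UniformContinuousOn f (Set.Ici 0))
    (hϑ : DerivOnIci ϑ ϑ') (hϑb : BoundedSignal ϑ) (hϑb' : BoundedSignal ϑ')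
    (hϑ' : Tendsto ϑ' atTop (𝓝 0))
    (hout : Tendsto (chainOutput F b c lam (fun t => ∑ i, ϑ t i • z t i)
      (fun t => f t ⬝ᵥ ϑ t) 0) atTop (𝓝 0)) :
    Tendsto (fun t => f t ⬝ᵥ ϑ t) atTop (𝓝 0) := by
  obtain ⟨ρ, h0, hκ⟩ :=
    exists_shiftedRow_dotProduct_ne_zero (lam := lam) (hurwitzPoly_numer hF hmp).1
  have hd : Tendsto (fun t => ∑ i, ϑ' t i • z t i) atTop (𝓝 0) := by
    simpa using tendsto_finsetSum Finset.univ fun i _ =>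
      (BoundedSignal.pi_iff.1 hzb i).tendsto_smul_zero ((tendsto_pi_nhds.1 hϑ') i)
  exact tendsto_input_zero hF hmp hlam h0 hκ (derivOnIci_combination hz hϑ) hd
    (uniformContinuousOn_chainOutput_combination hz hzb hfb hfc hϑ hϑb hϑb') hout

end Combination

section ClosedLoop

variable {n m q r : ℕ} {S : Plant n m} {k : Fin n → ℝ} {lam : ℝ} {D : Tuner q}
  {θ : Fin m → ℝ} {s : Signals n m q}

theorem Plant.errorMatrix_mulVec (S : Plant n m) (k v : Fin n → ℝ) :
    S.errorMatrix k *ᵥ v = S.A *ᵥ v - (S.c ⬝ᵥ v) • k := by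
  rw [Plant.errorMatrix, Matrix.sub_mulVec, Matrix.vecMulVec_mulVec, op_smul_eq_smul]

/-- The output error `e = y - ŷ` driving the tuner. -/
noncomputable def Signals.outputError (S : Plant n m) (s : Signals n m q) (t : ℝ) : ℝ :=
  S.c ⬝ᵥ s.x t - S.c ⬝ᵥ s.xhat t

/-- The state of the filter `W(p)` with input `φ(y)ᵀ θ - ν`, obtained by superposition from the
states of the filters of the closed loop. -/
noncomputable def Signals.filterError (θ : Fin m → ℝ) (s : Signals n m q) (t : ℝ) : Fin n → ℝ :=
  (∑ i, θ i • s.zφ t i) - s.zν t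

/-- The part of the observation error `x - x̂` due to the initial conditions: both `x - x̂` and
`Signals.filterError` are driven by the input `φ(y)ᵀ θ - ν`. -/
noncomputable def Signals.transient (θ : Fin m → ℝ) (s : Signals n m q) (t : ℝ) : Fin n → ℝ :=
  (s.x t - s.xhat t) - s.filterError θ t

/-- The deviations of the tuner filters from their equilibria `-ψ i • Γ⁻¹ h`. -/
noncomputable def Signals.tunerDeviation (D : Tuner q) (s : Signals n m q) (t : ℝ) :
    Fin m → Fin q → ℝ :=
  fun i => s.η t i + s.ψ t i • (D.Γ⁻¹ *ᵥ D.h)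

/-- The row reading the parameter estimate off the tuner filters. It is `0` if `r ≤ 2`, as the
filters are then omitted. -/
noncomputable def Tuner.readout (D : Tuner q) (r : ℕ) : Fin q → ℝ :=
  if r ≤ 2 then 0 else D.l

theorem Tuner.gain_readout_lt {P : Matrix (Fin q) (Fin q) ℝ} (hlam : 0 < lam)
    (hμ : D.μ > 3 / (4 * lam) *
      (‖WithLp.toLp 2 D.l‖ + ‖WithLp.toLp 2 ((P * D.Γ⁻¹) *ᵥ D.h)‖) ^ 2) (r : ℕ) :
    D.μ > 3 / (4 * lam) *
      (‖WithLp.toLp 2 (D.readout r)‖ + ‖WithLp.toLp 2 (P *ᵥ (D.Γ⁻¹ *ᵥ D.h))‖) ^ 2 := by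
  have hreadout : ‖WithLp.toLp 2 (D.readout r)‖ ≤ ‖WithLp.toLp 2 D.l‖ := by
    rw [Tuner.readout]
    split_ifs
    · simp
    · exact le_rfl
  rw [Matrix.mulVec_mulVec]
  refine lt_of_le_of_lt ?_ hμ
  gcongr

theorem boundedSignal_comp {E : Type*} [NormedAddCommGroup E] {g : ℝ → E} {y : ℝ → ℝ}
    (hg : ∀ B : Set ℝ, Bornology.IsBounded B → Bornology.IsBounded (g '' B))
    (hy : BoundedSignal y) : BoundedSignal fun t => g (y t) := by
  obtain ⟨C, hC⟩ := hy
  obtain ⟨K, hK⟩ := (hg _ (Metric.isBounded_closedBall (x := (0 : ℝ)) (r := C))).exists_norm_le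
  exact ⟨K, fun t ht => hK _ ⟨y t, mem_closedBall_zero_iff.2 (hC t ht), rfl⟩⟩

theorem BoundedSignal.of_outputError (hy : BoundedSignal fun t => S.c ⬝ᵥ s.x t)
    (he : BoundedSignal (s.outputError S)) : BoundedSignal fun t => S.c ⬝ᵥ s.xhat t :=
  (hy.sub he).congr fun _ _ => (sub_sub_cancel _ _).symm

theorem BoundedSignal.of_tunerDeviation (hψ : BoundedSignal s.ψ)
    (hξ : BoundedSignal (s.tunerDeviation D)) : BoundedSignal s.η :=
  pi_iff.2 fun i => ((pi_iff.1 hξ i).sub ((pi_iff.1 hψ i).smul (const (D.Γ⁻¹ *ᵥ D.h)))).congr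
    fun _ _ => (add_sub_cancel_right _ _).symm

namespace IsClosedLoop

variable (hs : IsClosedLoop S k lam r D θ s)

include hs

theorem derivOnIci_zφ (i : Fin m) :
    DerivOnIci (fun t => s.zφ t i) fun t =>
      S.errorMatrix k *ᵥ s.zφ t i + S.φ (S.c ⬝ᵥ s.x t) i • S.b :=
  (hs.regressor i).state

theorem derivOnIci_stateError :
    DerivOnIci (fun t => s.x t - s.xhat t) fun t =>
      S.errorMatrix k *ᵥ (s.x t - s.xhat t) + (S.φ (S.c ⬝ᵥ s.x t) ⬝ᵥ θ - s.ν t) • S.b := by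
  refine (DerivOnIci.sub hs.master hs.observer).congr_deriv fun t _ => ?_
  rw [Plant.errorMatrix_mulVec, Matrix.mulVec_sub, dotProduct_sub, sub_smul _ _ S.b]
  abel

theorem derivOnIci_filterError :
    DerivOnIci (s.filterError θ) fun t =>
      S.errorMatrix k *ᵥ s.filterError θ t + (S.φ (S.c ⬝ᵥ s.x t) ⬝ᵥ θ - s.ν t) • S.b := by
  refine ((derivOnIci_combination (f := fun t => S.φ (S.c ⬝ᵥ s.x t)) hs.derivOnIci_zφ
    (DerivOnIci.const θ)).sub hs.feedback.state).congr_deriv fun t _ => ?_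
  simp only [Signals.filterError, Matrix.mulVec_sub, sub_smul, Pi.zero_apply, zero_smul,
    Finset.sum_const_zero]
  abel

theorem derivOnIci_transient :
    DerivOnIci (s.transient θ) fun t => S.errorMatrix k *ᵥ s.transient θ t := by
  refine (hs.derivOnIci_stateError.sub hs.derivOnIci_filterError).congr_deriv fun t _ => ?_
  rw [Signals.transient, Matrix.mulVec_sub _ (s.x t - s.xhat t)]
  abel

theorem ϖ_eq (i : Fin m) {t : ℝ} (ht : 0 ≤ t) :
    s.ϖ t i = chainOutput (S.errorMatrix k) S.b S.c lam (fun t => s.zφ t i)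
      (fun t => S.φ (S.c ⬝ᵥ s.x t) i) 0 t :=
  (hs.regressor i).output t ht

theorem ϖ_dotProduct_eq (ϑ : ℝ → Fin m → ℝ) {t : ℝ} (ht : 0 ≤ t) :
    s.ϖ t ⬝ᵥ ϑ t = chainOutput (S.errorMatrix k) S.b S.c lam (fun t => ∑ i, ϑ t i • s.zφ t i)
      (fun t => S.φ (S.c ⬝ᵥ s.x t) ⬝ᵥ ϑ t) 0 t := by
  rw [chainOutput_combination (f := fun t => S.φ (S.c ⬝ᵥ s.x t)), dotProduct_comm]
  exact Finset.sum_congr rfl fun i _ => by rw [hs.ϖ_eq i ht]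

theorem feedback_eq {t : ℝ} (ht : 0 ≤ t) :
    s.ϖ t ⬝ᵥ s.θhat t = chainOutput (S.errorMatrix k) S.b S.c lam s.zν s.ν 0 t :=
  hs.feedback.output t ht

theorem ϖ_dotProduct_sub_θhat_eq {t : ℝ} (ht : 0 ≤ t) :
    s.ϖ t ⬝ᵥ (θ - s.θhat t) = chainOutput (S.errorMatrix k) S.b S.c lam (s.filterError θ)
      (fun t => S.φ (S.c ⬝ᵥ s.x t) ⬝ᵥ θ - s.ν t) 0 t := by
  rw [dotProduct_sub, hs.feedback_eq ht, hs.ϖ_dotProduct_eq (fun _ => θ) ht]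
  simp only [chainOutput, Signals.filterError, dotProduct_sub]
  ring

theorem derivOnIci_outputError :
    DerivOnIci (s.outputError S) fun t =>
      -lam * s.outputError S t + s.ϖ t ⬝ᵥ (θ - s.θhat t) +
        shiftedRow (S.errorMatrix k) S.c lam 1 ⬝ᵥ s.transient θ t := by
  have hread : ∀ t, s.outputError S t = S.c ⬝ᵥ (s.x t - s.xhat t) := fun t =>
    (dotProduct_sub _ _ _).symm
  refine ((hs.derivOnIci_stateError.const_dotProduct S.c).congr fun t _ => hread t).congr_deriv
    fun t ht => ?_
  rw [hs.ϖ_dotProduct_sub_θhat_eq ht, chainOutput, hread, Signals.transient,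
    dotProduct_sub _ _ (s.filterError θ t)]
  simp only [shiftedRow, add_dotProduct, smul_dotProduct, Matrix.mulVec_transpose,
    ← Matrix.dotProduct_mulVec, dotProduct_add, dotProduct_smul, smul_eq_mul]
  ring

theorem derivOnIci_tunerDeviation (hΓ : IsUnit D.Γ.det) :
    DerivOnIci (s.tunerDeviation D) fun t i =>
      (1 + D.μ * (s.ϖ t ⬝ᵥ s.ϖ t)) • (D.Γ *ᵥ s.tunerDeviation D t i) +
        (s.outputError S t * s.ϖ t i) • (D.Γ⁻¹ *ᵥ D.h) := by
  refine DerivOnIci.pi_iff.2 fun i => ?_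
  refine (DerivOnIci.add (hs.eta i) ((DerivOnIci.pi_iff.1 hs.psi i).smul
    (DerivOnIci.const (D.Γ⁻¹ *ᵥ D.h)))).congr_deriv fun t _ => ?_
  rw [Signals.tunerDeviation, Matrix.mulVec_add, Matrix.mulVec_smul, Matrix.mulVec_mulVec,
    Matrix.mul_nonsing_inv _ hΓ, Matrix.one_mulVec, smul_zero, zero_add]
  rfl

theorem θhat_eq (hgain : 3 ≤ r → D.l ⬝ᵥ (D.Γ⁻¹ *ᵥ D.h) = -1) {t : ℝ} (ht : 0 ≤ t) :
    s.θhat t = s.ψ t + fun i => D.readout r ⬝ᵥ s.tunerDeviation D t i := by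
  ext i
  rw [hs.estimate t ht i, Pi.add_apply, Tuner.readout]
  split_ifs with hr
  · rw [zero_dotProduct, add_zero]
  · rw [Signals.tunerDeviation, dotProduct_add, dotProduct_smul, hgain (by omega), smul_eq_mul]
    ring

theorem isErrorModel (hΓ : IsUnit D.Γ.det) (hgain : 3 ≤ r → D.l ⬝ᵥ (D.Γ⁻¹ *ᵥ D.h) = -1) :
    IsErrorModel D.Γ (D.readout r) (D.Γ⁻¹ *ᵥ D.h) lam D.μ θ (s.outputError S)
      (fun t => shiftedRow (S.errorMatrix k) S.c lam 1 ⬝ᵥ s.transient θ t) s.ϖ s.ψ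
      (s.tunerDeviation D) where
  error := hs.derivOnIci_outputError.congr_deriv fun t ht => by rw [hs.θhat_eq hgain ht]
  integrator := hs.psi
  filter := hs.derivOnIci_tunerDeviation hΓ

theorem boundedSignal_zφ (hF : HurwitzMatrix (S.errorMatrix k))
    (hφ : BoundedSignal fun t => S.φ (S.c ⬝ᵥ s.x t)) : BoundedSignal s.zφ :=
  BoundedSignal.pi_iff.2 fun i => hF.boundedSignal (hs.derivOnIci_zφ i)
    ((BoundedSignal.pi_iff.1 hφ i).smul (.const S.b))

theorem boundedSignal_ϖ (hφ : BoundedSignal fun t => S.φ (S.c ⬝ᵥ s.x t))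
    (hzφ : BoundedSignal s.zφ) : BoundedSignal s.ϖ :=
  BoundedSignal.pi_iff.2 fun i => ((BoundedSignal.pi_iff.1 hzφ i).chainOutput
    (BoundedSignal.pi_iff.1 hφ i) 0).congr fun _ ht => hs.ϖ_eq i ht

theorem uniformContinuousOn_φ (hcont : Continuous S.φ) (hx : BoundedSignal s.x)
    (hφ₀ : BoundedSignal fun t => S.φ₀ (S.c ⬝ᵥ s.x t))
    (hφ : BoundedSignal fun t => S.φ (S.c ⬝ᵥ s.x t)) :
    UniformContinuousOn (fun t => S.φ (S.c ⬝ᵥ s.x t)) (Set.Ici 0) := by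
  have hxc := DerivOnIci.uniformContinuousOn hs.master
    (((hx.mulVec S.A).add hφ₀).add ((hφ.dotProduct (.const θ)).smul (.const S.b)))
  exact hx.uniformContinuousOn_comp (Φ := fun v => S.φ (S.c ⬝ᵥ v)) (by fun_prop) hxc

theorem smoothBounded_transient (hF : HurwitzMatrix (S.errorMatrix k)) (ρ : ℕ) :
    SmoothBounded ρ (s.transient θ) :=
  .of_derivOnIci_mulVec (hF.boundedSignal (f := fun _ => 0)
    (hs.derivOnIci_transient.congr_deriv fun _ _ => (add_zero _).symm) (.const 0))
    hs.derivOnIci_transient ρ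

theorem tendsto_dotProduct_transient (hF : HurwitzMatrix (S.errorMatrix k)) (a : Fin n → ℝ) :
    Tendsto (fun t => a ⬝ᵥ s.transient θ t) atTop (𝓝 0) :=
  tendsto_const_dotProduct_zero a <| hF.tendsto_zero (f := fun _ => 0)
    (hs.derivOnIci_transient.congr_deriv fun _ _ => (add_zero _).symm) tendsto_const_nhds

theorem boundedSignal_xhat (hF : HurwitzMatrix (S.errorMatrix k)) (hx : BoundedSignal s.x)
    (hzφ : BoundedSignal s.zφ) (hzν : BoundedSignal s.zν) : BoundedSignal s.xhat := by
  have hfilter : BoundedSignal (s.filterError θ) := .sub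
    (.sum fun i _ => (BoundedSignal.const (θ i)).smul (BoundedSignal.pi_iff.1 hzφ i)) hzν
  exact ((hx.sub (hs.smoothBounded_transient hF 0).boundedSignal).sub hfilter).congr fun t _ => by
    rw [Signals.transient]
    abel

theorem boundedSignal_θhat (hgain : 3 ≤ r → D.l ⬝ᵥ (D.Γ⁻¹ *ᵥ D.h) = -1)
    (hψ : BoundedSignal s.ψ) (hξ : BoundedSignal (s.tunerDeviation D)) : BoundedSignal s.θhat := by
  have hread : BoundedSignal fun t i => D.readout r ⬝ᵥ s.tunerDeviation D t i :=
    BoundedSignal.pi_iff.2 fun i => (BoundedSignal.const _).dotProduct (BoundedSignal.pi_iff.1 hξ i)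
  exact (hψ.add hread).congr fun t ht => hs.θhat_eq hgain ht

theorem smoothBounded_ϖ {ρ : ℕ}
    (h0 : ∀ i < ρ, shiftedRow (S.errorMatrix k) S.c lam i ⬝ᵥ S.b = 0)
    (hφ : BoundedSignal fun t => S.φ (S.c ⬝ᵥ s.x t)) (hzφ : BoundedSignal s.zφ) :
    SmoothBounded ρ s.ϖ :=
  SmoothBounded.pi_iff.2 fun i => (smoothBounded_chainOutput (hs.derivOnIci_zφ i) h0
    (BoundedSignal.pi_iff.1 hzφ i) (BoundedSignal.pi_iff.1 hφ i) ρ 0 (zero_add ρ)).congr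
    fun _ ht => hs.ϖ_eq i ht

-- `W(p)⁻¹` differentiates its input as often as the relative degree of `W(p)` demands, and
-- `ϖᵀ θhat` has that many bounded derivatives.
theorem boundedSignal_feedback (hF : HurwitzMatrix (S.errorMatrix k)) (hmp : MinimumPhase (S.H k))
    (hlam : 0 < lam) (hΓ : IsUnit D.Γ.det) (hgain : 3 ≤ r → D.l ⬝ᵥ (D.Γ⁻¹ *ᵥ D.h) = -1)
    (hφ : BoundedSignal fun t => S.φ (S.c ⬝ᵥ s.x t)) (hzφ : BoundedSignal s.zφ)
    (he : BoundedSignal (s.outputError S)) (hψ : BoundedSignal s.ψ)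
    (hξ : BoundedSignal (s.tunerDeviation D)) : BoundedSignal s.ν ∧ BoundedSignal s.zν := by
  obtain ⟨ρ, h0, hκ⟩ :=
    exists_shiftedRow_dotProduct_ne_zero (lam := lam) (hurwitzPoly_numer hF hmp).1
  have hϖ := hs.smoothBounded_ϖ h0 hφ hzφ
  obtain ⟨-, hψ', hξ'⟩ := (hs.isErrorModel hΓ hgain).smoothBounded he hψ hξ
    ((SmoothBounded.const ρ _).dotProduct (hs.smoothBounded_transient hF ρ)) hϖ
  have hread : SmoothBounded ρ fun t i => D.readout r ⬝ᵥ s.tunerDeviation D t i :=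
    SmoothBounded.pi_iff.2 fun i =>
      (SmoothBounded.const ρ _).dotProduct (SmoothBounded.pi_iff.1 hξ'.of_succ i)
  exact boundedSignal_of_smoothBounded_output hF hmp hlam h0 hκ hs.feedback.state <|
    (hϖ.dotProduct (hψ'.of_succ.add hread)).congr fun t ht => by
      rw [← hs.feedback_eq ht, hs.θhat_eq hgain ht]

theorem tendsto_sub_ψ (hF : HurwitzMatrix (S.errorMatrix k)) (hmp : MinimumPhase (S.H k))
    (hlam : 0 < lam) (hΓ : IsUnit D.Γ.det) (hgain : 3 ≤ r → D.l ⬝ᵥ (D.Γ⁻¹ *ᵥ D.h) = -1)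
    (hPE : PersistentlyExciting fun t => S.φ (S.c ⬝ᵥ s.x t))
    (hφc : UniformContinuousOn (fun t => S.φ (S.c ⬝ᵥ s.x t)) (Set.Ici 0))
    (hzφ : BoundedSignal s.zφ) (he : BoundedSignal (s.outputError S)) (hψ : BoundedSignal s.ψ)
    (he0 : Tendsto (s.outputError S) atTop (𝓝 0))
    (hξ0 : Tendsto (s.tunerDeviation D) atTop (𝓝 0)) :
    Tendsto (fun t => θ - s.ψ t) atTop (𝓝 0) := by
  have hφ : BoundedSignal fun t => S.φ (S.c ⬝ᵥ s.x t) := hPE.2.1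
  have hϖ := hs.boundedSignal_ϖ hφ hzφ
  have hϑ : DerivOnIci (fun t => θ - s.ψ t) fun t => 0 - s.outputError S t • s.ϖ t :=
    (DerivOnIci.const θ).sub hs.psi
  have hϑb := (BoundedSignal.const θ).sub hψ
  have hϑb' := (BoundedSignal.const 0).sub (he.smul hϖ)
  have hϑ' : Tendsto (fun t => 0 - s.outputError S t • s.ϖ t) atTop (𝓝 0) := by
    simpa using (hϖ.tendsto_smul_zero he0).neg
  have hread : Set.EqOn (chainOutput (S.errorMatrix k) S.b S.c lam
      (fun t => ∑ i, (θ - s.ψ t) i • s.zφ t i) (fun t => S.φ (S.c ⬝ᵥ s.x t) ⬝ᵥ (θ - s.ψ t)) 0)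
      (fun t => s.ϖ t ⬝ᵥ (θ - s.ψ t)) (Set.Ici 0) := fun t ht =>
    (hs.ϖ_dotProduct_eq (fun t => θ - s.ψ t) ht).symm
  have hout := (hs.isErrorModel hΓ hgain).tendsto_regressor_error he0 hξ0
    (hs.tendsto_dotProduct_transient hF _) hϖ
    ((uniformContinuousOn_chainOutput_combination (f := fun t => S.φ (S.c ⬝ᵥ s.x t))
      hs.derivOnIci_zφ hzφ hφ hφc hϑ hϑb hϑb' 0).congr hread)
  exact hPE.tendsto_zero hϑ hϑ' <| tendsto_input_combination_zero
    (f := fun t => S.φ (S.c ⬝ᵥ s.x t)) hF hmp hlam hs.derivOnIci_zφ hzφ hφ hφc hϑ hϑb hϑb' hϑ' <|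
    hout.congr' <| by filter_upwards [eventually_ge_atTop 0] with t ht using (hread ht).symm

theorem tendsto_sub_θhat (hgain : 3 ≤ r → D.l ⬝ᵥ (D.Γ⁻¹ *ᵥ D.h) = -1)
    (hψ : Tendsto (fun t => θ - s.ψ t) atTop (𝓝 0))
    (hξ : Tendsto (s.tunerDeviation D) atTop (𝓝 0)) :
    Tendsto (fun t => ‖WithLp.toLp 2 (θ - s.θhat t)‖) atTop (𝓝 0) := by
  have hcont : Continuous fun p : (Fin m → ℝ) × (Fin m → Fin q → ℝ) =>
      ‖WithLp.toLp 2 (p.1 - fun i => D.readout r ⬝ᵥ p.2 i)‖ := by fun_prop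
  have hlim := (hcont.tendsto (0, 0)).comp (hψ.prodMk_nhds hξ)
  have hzero : (0 : Fin m → ℝ) - (fun i => D.readout r ⬝ᵥ (0 : Fin m → Fin q → ℝ) i) = 0 := by
    ext
    simp
  rw [hzero, WithLp.toLp_zero, norm_zero] at hlim
  refine hlim.congr' ?_
  filter_upwards [eventually_ge_atTop 0] with t ht
  rw [Function.comp_apply, hs.θhat_eq hgain ht, sub_sub]

end IsClosedLoop

end ClosedLoop

end HOT

open HOT

theorem theorem2_general {n m r q : ℕ} (S : HOT.Plant n m) (k : Fin n → ℝ) (lam : ℝ)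
    (D : HOT.Tuner q) (P : Matrix (Fin q) (Fin q) ℝ)
    (hloc : S.LocallyBoundedNonlinearities)
    (hcont : Continuous S.φ)
    (hF : HOT.HurwitzMatrix (S.errorMatrix k))
    (hlam : 0 < lam)
    (hgain : 3 ≤ r → D.l ⬝ᵥ (D.Γ⁻¹ *ᵥ D.h) = -1)
    (hP : P.PosDef) (hLyap : D.Γᵀ * P + P * D.Γ = -(2 : ℝ) • (1 : Matrix (Fin q) (Fin q) ℝ))
    (hμ : D.μ > 3 / (4 * lam) *
      (‖WithLp.toLp 2 D.l‖ + ‖WithLp.toLp 2 ((P * D.Γ⁻¹) *ᵥ D.h)‖) ^ 2)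
    (θ : Fin m → ℝ) (s : HOT.Signals n m q) (hs : HOT.IsClosedLoop S k lam r D θ s)
    (hx : HOT.BoundedSignal s.x) :
    (HOT.BoundedSignal s.x ∧
      HOT.BoundedSignal (fun t => S.c ⬝ᵥ s.x t) ∧
      HOT.BoundedSignal (fun t => S.φ₀ (S.c ⬝ᵥ s.x t)) ∧
      HOT.BoundedSignal (fun t => S.φ (S.c ⬝ᵥ s.x t)) ∧
      HOT.BoundedSignal (fun t => S.c ⬝ᵥ s.xhat t) ∧
      HOT.BoundedSignal s.zφ ∧ HOT.BoundedSignal s.ϖ ∧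
      HOT.BoundedSignal s.ψ ∧ HOT.BoundedSignal s.η ∧ HOT.BoundedSignal s.θhat ∧
      (HOT.MinimumPhase (S.H k) →
        HOT.BoundedSignal s.ν ∧ HOT.BoundedSignal s.zν ∧ HOT.BoundedSignal s.xhat) ∧
      Tendsto (fun t => S.c ⬝ᵥ s.x t - S.c ⬝ᵥ s.xhat t) atTop (𝓝 0)) ∧
    (HOT.PersistentlyExciting (fun t => S.φ (S.c ⬝ᵥ s.x t)) → HOT.MinimumPhase (S.H k) →
      Tendsto (fun t => ‖WithLp.toLp 2 (θ - s.θhat t)‖) atTop (𝓝 0)) := by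
  have hΓ := isUnit_det_of_lyapunov (by simpa using hP.isHermitian) hLyap
  have hmodel := hs.isErrorModel hΓ hgain
  have hε := hF.dissipated_dotProduct hs.derivOnIci_transient
    (shiftedRow (S.errorMatrix k) S.c lam 1)
  have hεb := (BoundedSignal.const (shiftedRow (S.errorMatrix k) S.c lam 1)).dotProduct
    (hs.smoothBounded_transient hF 0).boundedSignal
  have hμ' := Tuner.gain_readout_lt hlam hμ r
  have hy : BoundedSignal fun t => S.c ⬝ᵥ s.x t := (BoundedSignal.const S.c).dotProduct hx
  have hφ₀ := boundedSignal_comp (fun B hB => (hloc B hB).1) hy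
  have hφ := boundedSignal_comp (fun B hB => (hloc B hB).2) hy
  have hzφ := hs.boundedSignal_zφ hF hφ
  have hϖ := hs.boundedSignal_ϖ hφ hzφ
  obtain ⟨he, hψ, hξ⟩ := hmodel.boundedSignal hP hLyap hlam hμ' hε
  obtain ⟨he0, hξ0⟩ := hmodel.tendsto_zero hP hLyap hlam hμ' hε hεb hϖ
  refine ⟨⟨hx, hy, hφ₀, hφ, hy.of_outputError he, hzφ, hϖ, hψ, hψ.of_tunerDeviation hξ,
    hs.boundedSignal_θhat hgain hψ hξ, fun hmp => ?_, he0⟩, fun hPE hmp => ?_⟩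
  · obtain ⟨hν, hzν⟩ := hs.boundedSignal_feedback hF hmp hlam hΓ hgain hφ hzφ he hψ hξ
    exact ⟨hν, hzν, hs.boundedSignal_xhat hF hx hzφ hzν⟩
  · exact hs.tendsto_sub_θhat hgain (hs.tendsto_sub_ψ hF hmp hlam hΓ hgain hPE
      (hs.uniformContinuousOn_φ hcont hx hφ₀ hφ) hzφ he hψ he0 hξ0) hξ0

theorem theorem2 {n m r q : ℕ} (S : HOT.Plant n m) (k : Fin n → ℝ) (lam : ℝ) (D : HOT.Tuner q)
    (α : Polynomial ℝ) (P : Matrix (Fin q) (Fin q) ℝ)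
    (hbdd : S.BoundedTrajectories)
    (hloc : S.LocallyBoundedNonlinearities)
    (hcont : Continuous S.φ)
    (hF : HOT.HurwitzMatrix (S.errorMatrix k))
    (hr : HOT.HasRelativeDegree (S.H k) r)
    (hlam : 0 < lam)
    -- `(l, Γ, h)` is a minimal realization (of dimension `deg α = r - 2`) of `α(0)/α(p)`;
    -- for `r ≤ 2` there is no such filter
    (hq : q = r - 2)
    (hα : HOT.HurwitzPoly α) (hαdeg : α.natDegree = q)
    (hreal : 3 ≤ r → HOT.transferFn D.Γ D.h D.l 0 =
      RatFunc.C (α.eval 0) / algebraMap (Polynomial ℝ) (RatFunc ℝ) α)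
    (hP : P.PosDef) (hLyap : D.Γᵀ * P + P * D.Γ = -(2 : ℝ) • (1 : Matrix (Fin q) (Fin q) ℝ))
    (hμ : D.μ > 3 / (4 * lam) *
      (‖WithLp.toLp 2 D.l‖ + ‖WithLp.toLp 2 ((P * D.Γ⁻¹) *ᵥ D.h)‖) ^ 2)
    (θ : Fin m → ℝ) (s : HOT.Signals n m q) (hs : HOT.IsClosedLoop S k lam r D θ s) :
    -- (i)
    (HOT.BoundedSignal s.x ∧
      HOT.BoundedSignal (fun t => S.c ⬝ᵥ s.x t) ∧
      HOT.BoundedSignal (fun t => S.φ₀ (S.c ⬝ᵥ s.x t)) ∧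
      HOT.BoundedSignal (fun t => S.φ (S.c ⬝ᵥ s.x t)) ∧
      HOT.BoundedSignal (fun t => S.c ⬝ᵥ s.xhat t) ∧
      HOT.BoundedSignal s.zφ ∧ HOT.BoundedSignal s.ϖ ∧
      HOT.BoundedSignal s.ψ ∧ HOT.BoundedSignal s.η ∧ HOT.BoundedSignal s.θhat ∧
      (HOT.MinimumPhase (S.H k) →
        HOT.BoundedSignal s.ν ∧ HOT.BoundedSignal s.zν ∧ HOT.BoundedSignal s.xhat) ∧
      Tendsto (fun t => S.c ⬝ᵥ s.x t - S.c ⬝ᵥ s.xhat t) atTop (𝓝 0)) ∧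
    -- (ii)
    (HOT.PersistentlyExciting (fun t => S.φ (S.c ⬝ᵥ s.x t)) → HOT.MinimumPhase (S.H k) →
      Tendsto (fun t => ‖WithLp.toLp 2 (θ - s.θhat t)‖) atTop (𝓝 0)) := by
  have hΓ := isUnit_det_of_lyapunov (by simpa using hP.isHermitian) hLyap
  exact theorem2_general S k lam D P hloc hcont hF hlam
    (fun h3 => dotProduct_inv_mulVec_of_transferFn_eq hα.eval_zero_ne_zero hΓ (hreal h3))
    hP hLyap hμ θ s hs (hbdd θ s.x hs.master)
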